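/- Let \(\beta\in\mathbb R\setminus\{0,1\}\) and let \(d=d(n)\), \(n\in\mathbb N\), be nonzero real constants; the index \(1\) denotes the shift \(n\mapsto n+1\), so \(d_1=d(n+1)\), \(u_1=u(x,n+1)\), \(v_1=v(x,n+1)\). Consider a semi-discrete system \[u_{1x}=f(x,n,u,v,u_x,v_x,u_1,v_1),\qquad v_{1x}=g(x,n,u,v,u_x,v_x,u_1,v_1)\] for real functions \(u(x,n),v(x,n)\), with \(f(\cdot,n,\cdot),g(\cdot,n,\cdot)\) smooth on an open set \(\Omega_n\) of values of \((x,u,v,u_1,v_1,u_x,v_x)\) whose slices \(\{(x,u_x,v_x)\}\) at fixed \((u,v,u_1,v_1)\) are connected. Assume that on \(\Omega_n\) the numbers \(u_x\), \(uv+d\), \(u_1v_1+d_1\) are positive or, if \(\beta\) is an integer, nonzero, so that their real powers are defined. An expression \(J\) in \(n,u,v,u_x,v_x,u_{xx},v_{xx}\) is an \(n\)-integral if on every (local, \(C^2\)) solution \(J\) is defined at \(n\) and at \(n+1\) and takes the same value at both. The system admits the two \(n\)-integrals \[I_3=\frac{u_x^\beta v_x}{(uv+d)^\beta}+\frac{\beta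 v^2u_x^{\beta+1}}{(uv+d)^{\beta+1}},\qquad J_3=-\frac{u_{xx}}{u_x}+\frac{2vu_x+uv_x}{uv+d}\] if and only if, for each \(n\), it has the form \[u_{1x}=\frac{u_1v_1+d_1}{\mathcal D_3(uv+d)}\,u_x,\qquad v_{1x}=\left(\frac{-\beta v_1^2}{\mathcal D_3(uv+d)}+\frac{\beta v^2\mathcal D_3^\beta}{uv+d}\right)u_x+\mathcal D_3^\beta v_x\] with a smooth function \(\mathcal D_3=\mathcal D_3(u,v,u_1,v_1)\) (depending on \(n\)), with values that are positive or, if \(\beta\) is an integer, nonzero, defined on the projection of \(\Omega_n\) to the variables \((u,v,u_1,v_1)\), such that at every point of this projection either \(v_1-v\mathcal D_3^\beta=0\), or \(\mathcal D_3\) is, near that point, given implicitly by an equation \(H(K_3,L_3)=0\). Here \(H\) is some smooth function of two variables such that the derivative of \(H(K_3,L_3)\) with respect to \(\mathcal D_3\), at fixed \((u,v,u_1,v_1)\), is nonzero at the solution, and \[K_3=\frac{|v_1-v\mathcal D_3^\beta|^{1/\beta}\,(d_1u-du_1\mathcal D_3)}{\mathcal D_3},\qquad L_3=|v_1-v\mathcal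 D_3^\beta|^{(1-\beta)/\beta}\bigl(d_1\mathcal D_3^{\beta-1}-d_1+(\beta-1)u_1(v_1-v\mathcal D_3^\beta)\bigr).\] -/

import Mathlib

open Filter Topology
open scoped ContDiff

noncomputable section

namespace SemiDiscrete

/-- The variables `(u, v, u₁, v₁)`; the index `₁` stands for the shift `n ↦ n + 1`. -/
abbrev Base : Type := ℝ × ℝ × ℝ × ℝ

/-- The arguments `(x, (u, v, u₁, v₁), u_x, v_x)` of the right-hand sides of a system, at a
fixed `n`. -/
abbrev Args : Type := ℝ × Base × ℝ × ℝ

/-- A semi-discrete system `u₁ₓ = f(x,n,u,v,u₁,v₁,uₓ,vₓ)`, `v₁ₓ = g(x,n,u,v,u₁,v₁,uₓ,vₓ)`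
with smooth right-hand sides on an open domain (which may depend on `n`). The domain is
such that a function on it which locally depends on `(u, v, u₁, v₁)` only is a function of
`(u, v, u₁, v₁)`: its slices in the directions `(x, uₓ, vₓ)` are connected. -/
structure System where
  dom : ℕ → Set Args
  f : ℕ → Args → ℝ
  g : ℕ → Args → ℝ
  isOpen_dom : ∀ n, IsOpen (dom n)
  slice_connected : ∀ n, ∀ q : Base, IsPreconnected {y : ℝ × ℝ × ℝ | (y.1, q, y.2) ∈ dom n}
  smooth_f : ∀ n, ContDiffOn ℝ ∞ (f n) (dom n)
  smooth_g : ∀ n, ContDiffOn ℝ ∞ (g n) (dom n)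

/-- The set of values `(u, v, u₁, v₁)` that occur in the domain of the system. -/
def System.baseDom (S : System) (n : ℕ) : Set Base := (fun p : Args => p.2.1) '' S.dom n

/-- `u, v` form a (classical, local) solution of the system, for `x ∈ (a, b)` and on the
segment `m, …, M` of the lattice. -/
def System.IsSolution (S : System) (a b : ℝ) (m M : ℕ) (u v : ℕ → ℝ → ℝ) : Prop :=
  (∀ n, m ≤ n → n ≤ M →
    ContDiffOn ℝ 2 (u n) (Set.Ioo a b) ∧ ContDiffOn ℝ 2 (v n) (Set.Ioo a b)) ∧
  ∀ n, m ≤ n → n < M → ∀ x ∈ Set.Ioo a b,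
    (x, (u n x, v n x, u (n + 1) x, v (n + 1) x), deriv (u n) x, deriv (v n) x) ∈ S.dom n ∧
    deriv (u (n + 1)) x =
      S.f n (x, (u n x, v n x, u (n + 1) x, v (n + 1) x), deriv (u n) x, deriv (v n) x) ∧
    deriv (v (n + 1)) x =
      S.g n (x, (u n x, v n x, u (n + 1) x, v (n + 1) x), deriv (u n) x, deriv (v n) x)

/-- Second-order jets `(x, (u, v), (uₓ, vₓ), (uₓₓ, vₓₓ))`. -/
abbrev Jet : Type := ℝ × (ℝ × ℝ) × (ℝ × ℝ) × (ℝ × ℝ)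

/-- The second-order jet of a pair of functions at `x`. -/
def jet (u v : ℝ → ℝ) (x : ℝ) : Jet :=
  (x, (u x, v x), (deriv u x, deriv v x), (deriv (deriv u) x, deriv (deriv v) x))

/-- An expression `J(x, n, q, qₓ, qₓₓ)`, `q = (u, v)`, with its domain of definition. -/
structure JetFunction where
  dom : ℕ → Set Jet
  val : ℕ → Jet → ℝ

/-- `J` is an `n`-integral of the system: on all solutions, `J` is defined and `D J = J`,
where `D` is the shift operator. -/
def System.IsNIntegral (S : System) (J : JetFunction) : Prop :=
  ∀ (a b : ℝ) (m M : ℕ) (u v : ℕ → ℝ → ℝ), S.IsSolution a b m M u v →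
    ∀ n, m ≤ n → n < M → ∀ x ∈ Set.Ioo a b,
      jet (u n) (v n) x ∈ J.dom n ∧
      jet (u (n + 1)) (v (n + 1)) x ∈ J.dom (n + 1) ∧
      J.val (n + 1) (jet (u (n + 1)) (v (n + 1)) x) = J.val n (jet (u n) (v n) x)

/-- The set of nonzero reals `y` for which `y ^ β` makes sense as a real power: all
positive ones, and also the negative ones if `β` is an integer. -/
def powDom (β : ℝ) : Set ℝ := {y | 0 < y ∨ (y ≠ 0 ∧ ∃ k : ℤ, β = k)}

/-- `I₃ = uₓ^β vₓ / (uv+d)^β + β v² uₓ^(β+1) / (uv+d)^(β+1)`. -/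
def I₃ (β : ℝ) (d : ℕ → ℝ) : JetFunction where
  dom n := {j | match j with
    | (_, (u, v), (ux, _), _) => ux ∈ powDom β ∧ u * v + d n ∈ powDom β}
  val n j := match j with
    | (_, (u, v), (ux, vx), _) =>
      ux ^ β * vx / (u * v + d n) ^ β
        + β * v ^ 2 * ux ^ (β + 1) / (u * v + d n) ^ (β + 1)

/-- `J₃ = - uₓₓ / uₓ + (2 v uₓ + u vₓ) / (uv+d)`. -/
def J₃ (d : ℕ → ℝ) : JetFunction where
  dom n := {j | match j with
    | (_, (u, v), (ux, _), _) => ux ≠ 0 ∧ u * v + d n ≠ 0}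
  val n j := match j with
    | (_, (u, v), (ux, vx), (uxx, _)) =>
      - uxx / ux + (2 * v * ux + u * vx) / (u * v + d n)

/-- The domain of the system lies in the region where the real powers of `uₓ`, `uv+d` and
`u₁v₁+d₁` in the two integrals and in their shifts are defined. -/
def System.Admissible (S : System) (β : ℝ) (d : ℕ → ℝ) : Prop :=
  ∀ n x u v u₁ v₁ ux vx, (x, (u, v, u₁, v₁), ux, vx) ∈ S.dom n →
    ux ∈ powDom β ∧ u * v + d n ∈ powDom β ∧ u₁ * v₁ + d (n + 1) ∈ powDom β

/-- `K₃` as a function of `(u, v, u₁, v₁)` and of the value `t` of `𝒟₃`. The absolute value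
changes `K₃` by a constant factor at most, on either side of `v₁ = v t^β`. -/
def K₃ (β d d₁ : ℝ) : Base → ℝ → ℝ
  | (u, v, u₁, v₁), t => |v₁ - v * t ^ β| ^ (β⁻¹) * (d₁ * u - d * u₁ * t) / t

/-- `L₃` as a function of `(u, v, u₁, v₁)` and of the value `t` of `𝒟₃`. -/
def L₃ (β d₁ : ℝ) : Base → ℝ → ℝ
  | (_, v, u₁, v₁), t =>
    |v₁ - v * t ^ β| ^ ((1 - β) * β⁻¹)
      * (d₁ * t ^ (β - 1) - d₁ + (β - 1) * u₁ * (v₁ - v * t ^ β))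

/-- Near `q`, the function `𝒟` is given implicitly by `H(K₃, L₃) = 0` for some smooth `H`:
it solves the equation, and the derivative of the left-hand side with respect to the
unknown does not vanish there. -/
def GivenImplicitlyAt (β d d₁ : ℝ) (𝒟 : Base → ℝ) (q : Base) : Prop :=
  ∃ H : ℝ × ℝ → ℝ, ContDiff ℝ ∞ H ∧
    ∀ᶠ p in 𝓝 q, H (K₃ β d d₁ p (𝒟 p), L₃ β d₁ p (𝒟 p)) = 0 ∧
      deriv (fun t => H (K₃ β d d₁ p t, L₃ β d₁ p t)) (𝒟 p) ≠ 0

/-- The system has the form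
`u₁ₓ = (u₁v₁+d₁) / (𝒟 (uv+d)) uₓ`,
`v₁ₓ = (- β v₁² / (𝒟 (uv+d)) + β v² 𝒟^β / (uv+d)) uₓ + 𝒟^β vₓ`
with a smooth `𝒟 = 𝒟(n, u, v, u₁, v₁)` which, at every point, either satisfies
`v₁ - v 𝒟^β = 0` or is given implicitly near that point by `H(K₃, L₃) = 0`. -/
def System.HasForm₃ (S : System) (β : ℝ) (d : ℕ → ℝ) : Prop :=
  ∀ n, ∃ 𝒟 : Base → ℝ, ContDiffOn ℝ ∞ 𝒟 (S.baseDom n) ∧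
    (∀ q ∈ S.baseDom n, 𝒟 q ∈ powDom β) ∧
    (∀ x u v u₁ v₁ ux vx, (x, (u, v, u₁, v₁), ux, vx) ∈ S.dom n →
      S.f n (x, (u, v, u₁, v₁), ux, vx) =
        (u₁ * v₁ + d (n + 1)) / (𝒟 (u, v, u₁, v₁) * (u * v + d n)) * ux ∧
      S.g n (x, (u, v, u₁, v₁), ux, vx) =
        (-β * v₁ ^ 2 / (𝒟 (u, v, u₁, v₁) * (u * v + d n))
          + β * v ^ 2 * 𝒟 (u, v, u₁, v₁) ^ β / (u * v + d n)) * ux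
          + 𝒟 (u, v, u₁, v₁) ^ β * vx) ∧
    ∀ u v u₁ v₁, (u, v, u₁, v₁) ∈ S.baseDom n →
      v₁ - v * 𝒟 (u, v, u₁, v₁) ^ β = 0 ∨
        GivenImplicitlyAt β (d n) (d (n + 1)) 𝒟 (u, v, u₁, v₁)

end SemiDiscrete

end

noncomputable section

namespace SemiDiscrete

/-! ### Real powers on `powDom` -/

/-! Write t for the value of 𝒟₃ and W = v₁ - v t^β. Invariance of I₃ is linear in v₁ₓ, so it only
determines g from f (`System.g_eq`); f itself is encoded by the quotient t = `System.quot`.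
Differentiating log t along a solution turns invariance of J₃ into D_x t = uₓ (v t - v₁)/(uv+d)
(`System.fderiv_quot`). Solutions exist through every point with arbitrary uₓₓ and vₓₓ
(`System.exists_isSolution`), so t does not depend on uₓ, vₓ. The identity is then affine in (uₓ,
vₓ), and its coefficients say that t is independent of x and satisfies two quasilinear first-order
equations, `CharEqAt`.

The characteristic fields of these equations on the space of (u, v, u₁, v₁, t) are X = ∂_v + t^β
∂_{v₁} and Y = t(uv+d) ∂_u + (u₁v₁+d₁) ∂_{u₁} + β(v² t t^β - v₁²) ∂_{v₁} + t(vt - v₁) ∂_t. Both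
annihilate K₃ and L₃, hence are tangent to any nondegenerate H(K₃, L₃) = 0; this gives the direction
from the implicit form to the integrals. At points with W = 0 the equations follow by continuity, or
from XW = 0 and YW = -β v₁ W if W vanishes on a neighbourhood.

Conversely, a solution also satisfies the equation of the commutator of X and Y
(`fderiv_commutator`). Where W ≠ 0 the three equations make its graph tangent to the
three-dimensional level sets of (K₃, L₃) (`fderiv_level`). These level sets have the explicit chart
`levelChart`. A Gronwall estimate along segments in this chart shows that the graph is locally a
union of pieces of level sets (`eventually_eq_levelChart`), and restricting t - 𝒟 to a transversal
with v, v₁, t fixed yields H (`givenImplicitlyAt_of_charEqAt`). -/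

theorem ne_zero_of_mem_powDom {β y : ℝ} (h : y ∈ powDom β) : y ≠ 0 := by
  rcases h with h | h
  · exact h.ne'
  · exact h.1

theorem mul_mem_powDom {β x y : ℝ} (hx : x ∈ powDom β) (hy : y ∈ powDom β) :
    x * y ∈ powDom β := by
  have hx0 := ne_zero_of_mem_powDom hx
  have hy0 := ne_zero_of_mem_powDom hy
  rcases hx with hx | hx
  · rcases hy with hy | hy
    · exact Or.inl (mul_pos hx hy)
    · exact Or.inr ⟨mul_ne_zero hx0 hy0, hy.2⟩
  · exact Or.inr ⟨mul_ne_zero hx0 hy0, hx.2⟩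

theorem inv_mem_powDom {β x : ℝ} (hx : x ∈ powDom β) : x⁻¹ ∈ powDom β := by
  rcases hx with hx | hx
  · exact Or.inl (inv_pos.2 hx)
  · exact Or.inr ⟨inv_ne_zero hx.1, hx.2⟩

theorem div_mem_powDom {β x y : ℝ} (hx : x ∈ powDom β) (hy : y ∈ powDom β) :
    x / y ∈ powDom β := by
  rw [div_eq_mul_inv]
  exact mul_mem_powDom hx (inv_mem_powDom hy)

theorem rpow_ne_zero_of_mem_powDom {β x : ℝ} (hx : x ∈ powDom β) : x ^ β ≠ 0 := by
  rcases hx with hx | ⟨hx, k, rfl⟩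
  · exact (Real.rpow_pos_of_pos hx β).ne'
  · rw [Real.rpow_intCast]
    exact zpow_ne_zero k hx

theorem mul_rpow_of_mem_powDom {β x y : ℝ} (hx : x ∈ powDom β) (hy : y ∈ powDom β) :
    (x * y) ^ β = x ^ β * y ^ β := by
  have aux : ∀ k : ℤ, (x * y) ^ (k : ℝ) = x ^ (k : ℝ) * y ^ (k : ℝ) := fun k => by
    simp only [Real.rpow_intCast, mul_zpow]
  rcases hx with hx | ⟨_, k, rfl⟩
  · rcases hy with hy | ⟨_, k, rfl⟩
    · exact Real.mul_rpow hx.le hy.le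
    · exact aux k
  · exact aux k

theorem inv_rpow_of_mem_powDom {β x : ℝ} (hx : x ∈ powDom β) : x⁻¹ ^ β = (x ^ β)⁻¹ := by
  rcases hx with hx | ⟨_, k, rfl⟩
  · exact Real.inv_rpow hx.le β
  · simp only [Real.rpow_intCast, inv_zpow]

theorem div_rpow_of_mem_powDom {β x y : ℝ} (hx : x ∈ powDom β) (hy : y ∈ powDom β) :
    (x / y) ^ β = x ^ β / y ^ β := by
  rw [div_eq_mul_inv, mul_rpow_of_mem_powDom hx (inv_mem_powDom hy), inv_rpow_of_mem_powDom hy,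
    div_eq_mul_inv]

/-! ### Derivatives of powers -/

/-- `Real.log` is even, so one exponential formula covers both signs of the base. -/
theorem abs_rpow_eventuallyEq (c : ℝ) {y : ℝ} (hy : y ≠ 0) :
    (fun z : ℝ => |z| ^ c) =ᶠ[𝓝 y] fun z => Real.exp (Real.log z * c) := by
  filter_upwards [isOpen_ne.mem_nhds hy] with z hz
  rw [Real.rpow_def_of_pos (abs_pos.2 hz), Real.log_abs]

theorem contDiffAt_abs_rpow (c : ℝ) {y : ℝ} (hy : y ≠ 0) :
    ContDiffAt ℝ ∞ (fun z : ℝ => |z| ^ c) y := by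
  refine ContDiffAt.congr_of_eventuallyEq ?_ (abs_rpow_eventuallyEq c hy)
  exact ((Real.contDiffAt_log.2 hy).mul contDiffAt_const).exp

theorem hasDerivAt_abs_rpow (c : ℝ) {y : ℝ} (hy : y ≠ 0) :
    HasDerivAt (fun z : ℝ => |z| ^ c) (c * |y| ^ c / y) y := by
  refine HasDerivAt.congr_of_eventuallyEq ?_ (abs_rpow_eventuallyEq c hy)
  have h := ((Real.hasDerivAt_log hy).mul_const c).exp
  refine h.congr_deriv ?_
  rw [Real.rpow_def_of_pos (abs_pos.2 hy), Real.log_abs]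
  ring

theorem hasDerivAt_abs_rpow_comp (c : ℝ) {w : ℝ → ℝ} {w' s : ℝ} (hw : HasDerivAt w w' s)
    (h0 : w s ≠ 0) : HasDerivAt (fun z => |w z| ^ c) (c * |w s| ^ c / w s * w') s :=
  (hasDerivAt_abs_rpow c h0).comp s hw

theorem hasDerivAt_rpow_comp (c : ℝ) {t : ℝ → ℝ} {t' s : ℝ} (ht : HasDerivAt t t' s)
    (h0 : t s ≠ 0) : HasDerivAt (fun z => t z ^ c) (c * (t s ^ c / t s) * t') s := by
  have h := (Real.hasDerivAt_rpow_const (p := c) (Or.inl h0)).comp s ht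
  rwa [Real.rpow_sub_one h0] at h

theorem hasDerivAt_base {a b c e : ℝ → ℝ} {a' b' c' e' s : ℝ} (ha : HasDerivAt a a' s)
    (hb : HasDerivAt b b' s) (hc : HasDerivAt c c' s) (he : HasDerivAt e e' s) :
    HasDerivAt (fun z => ((a z, b z, c z, e z) : Base)) (a', b', c', e') s :=
  ha.prodMk (hb.prodMk (hc.prodMk he))

theorem hasDerivAt_add_mul (a b : ℝ) : HasDerivAt (fun s : ℝ => a + s * b) b 0 := by
  simpa using ((hasDerivAt_id (0 : ℝ)).mul_const b).const_add a

/-! ### The functions `K₃` and `L₃` -/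

theorem contDiffAt_sub_mul_rpow (β : ℝ) {z : Base × ℝ} (ht : z.2 ≠ 0) :
    ContDiffAt ℝ ∞ (fun z : Base × ℝ => z.1.2.2.2 - z.1.2.1 * z.2 ^ β) z := by
  have hp : ContDiffAt ℝ ∞ (fun z : Base × ℝ => z.2 ^ β) z :=
    (Real.contDiffAt_rpow_const_of_ne ht).comp z contDiffAt_snd
  fun_prop

theorem contDiffAt_K₃ (β d d₁ : ℝ) {z : Base × ℝ} (ht : z.2 ≠ 0)
    (hW : z.1.2.2.2 - z.1.2.1 * z.2 ^ β ≠ 0) :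
    ContDiffAt ℝ ∞ (fun z : Base × ℝ => K₃ β d d₁ z.1 z.2) z := by
  have hw : ContDiffAt ℝ ∞ (fun z : Base × ℝ => |z.1.2.2.2 - z.1.2.1 * z.2 ^ β| ^ β⁻¹) z :=
    (contDiffAt_abs_rpow β⁻¹ hW).comp (f := fun z : Base × ℝ => z.1.2.2.2 - z.1.2.1 * z.2 ^ β) z
      (contDiffAt_sub_mul_rpow β ht)
  have h : ContDiffAt ℝ ∞ (fun z : Base × ℝ =>
      |z.1.2.2.2 - z.1.2.1 * z.2 ^ β| ^ β⁻¹ * (d₁ * z.1.1 - d * z.1.2.2.1 * z.2) / z.2) z := by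
    refine ContDiffAt.div (hw.mul ?_) contDiffAt_snd ht
    fun_prop
  exact h

theorem contDiffAt_L₃ (β d₁ : ℝ) {z : Base × ℝ} (ht : z.2 ≠ 0)
    (hW : z.1.2.2.2 - z.1.2.1 * z.2 ^ β ≠ 0) :
    ContDiffAt ℝ ∞ (fun z : Base × ℝ => L₃ β d₁ z.1 z.2) z := by
  have hw : ContDiffAt ℝ ∞
      (fun z : Base × ℝ => |z.1.2.2.2 - z.1.2.1 * z.2 ^ β| ^ ((1 - β) * β⁻¹)) z :=
    (contDiffAt_abs_rpow _ hW).comp (f := fun z : Base × ℝ => z.1.2.2.2 - z.1.2.1 * z.2 ^ β) z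
      (contDiffAt_sub_mul_rpow β ht)
  have hp : ContDiffAt ℝ ∞ (fun z : Base × ℝ => z.2 ^ (β - 1)) z :=
    (Real.contDiffAt_rpow_const_of_ne ht).comp z contDiffAt_snd
  have hp' : ContDiffAt ℝ ∞ (fun z : Base × ℝ => z.2 ^ β) z :=
    (Real.contDiffAt_rpow_const_of_ne ht).comp z contDiffAt_snd
  have h : ContDiffAt ℝ ∞ (fun z : Base × ℝ =>
      |z.1.2.2.2 - z.1.2.1 * z.2 ^ β| ^ ((1 - β) * β⁻¹) *
        (d₁ * z.2 ^ (β - 1) - d₁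
          + (β - 1) * z.1.2.2.1 * (z.1.2.2.2 - z.1.2.1 * z.2 ^ β))) z := by
    refine hw.mul ?_
    fun_prop
  exact h

/-- `K₃` is constant along the field `∂_v + t^β ∂_{v₁}`. -/
theorem K₃_add_first (β d d₁ u v u₁ v₁ t s : ℝ) :
    K₃ β d d₁ (u, v + s, u₁, v₁ + s * t ^ β) t = K₃ β d d₁ (u, v, u₁, v₁) t := by
  simp only [K₃]
  rw [show v₁ + s * t ^ β - (v + s) * t ^ β = v₁ - v * t ^ β by ring]

/-- `L₃` is constant along the field `∂_v + t^β ∂_{v₁}`. -/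
theorem L₃_add_first (β d₁ u v u₁ v₁ t s : ℝ) :
    L₃ β d₁ (u, v + s, u₁, v₁ + s * t ^ β) t = L₃ β d₁ (u, v, u₁, v₁) t := by
  simp only [L₃]
  rw [show v₁ + s * t ^ β - (v + s) * t ^ β = v₁ - v * t ^ β by ring]

section SecondField

variable {β d d₁ u v u₁ v₁ t : ℝ}

/-- W = v₁ - v t^β is an eigenfunction of the second field, with factor -β v₁. The exponents 1/β and
(1-β)/β in K₃ and L₃ are such that the factors of the powers of |W| cancel the factors v₁ and -(β-1)
v₁ of what they multiply. -/
theorem hasDerivAt_sub_mul_rpow_second (ht : t ≠ 0) :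
    HasDerivAt (fun s : ℝ => v₁ + s * (β * (v ^ 2 * t * t ^ β - v₁ ^ 2))
      - v * (t + s * (t * (v * t - v₁))) ^ β) (-β * v₁ * (v₁ - v * t ^ β)) 0 := by
  have h1 := hasDerivAt_add_mul v₁ (β * (v ^ 2 * t * t ^ β - v₁ ^ 2))
  have h2 := hasDerivAt_rpow_comp β (hasDerivAt_add_mul t (t * (v * t - v₁))) (by simpa using ht)
  refine (h1.sub (h2.const_mul v)).congr_deriv ?_
  simp only [zero_mul, add_zero]
  field_simp
  ring

/-- `K₃` is constant to first order along the second characteristic field. -/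
theorem hasDerivAt_K₃_second (hβ : β ≠ 0) (ht : t ≠ 0) (hW : v₁ - v * t ^ β ≠ 0) :
    HasDerivAt (fun s : ℝ => K₃ β d d₁
      (u + s * (t * (u * v + d)), v, u₁ + s * (u₁ * v₁ + d₁),
        v₁ + s * (β * (v ^ 2 * t * t ^ β - v₁ ^ 2))) (t + s * (t * (v * t - v₁)))) 0 0 := by
  have hw := hasDerivAt_abs_rpow_comp β⁻¹
    (hasDerivAt_sub_mul_rpow_second (β := β) (v := v) (v₁ := v₁) ht) (by simpa using hW)
  have hu := hasDerivAt_add_mul u (t * (u * v + d))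
  have hu₁ := hasDerivAt_add_mul u₁ (u₁ * v₁ + d₁)
  have h := hasDerivAt_add_mul t (t * (v * t - v₁))
  have := (hw.mul ((hu.const_mul d₁).sub ((hu₁.const_mul d).mul h))).div h (by simpa using ht)
  refine this.congr_deriv ?_
  simp only [Pi.sub_apply, Pi.mul_apply, zero_mul, add_zero]
  field_simp
  ring

/-- `L₃` is constant to first order along the second characteristic field. -/
theorem hasDerivAt_L₃_second (hβ : β ≠ 0) (ht : t ≠ 0) (hW : v₁ - v * t ^ β ≠ 0) :
    HasDerivAt (fun s : ℝ => L₃ β d₁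
      (u + s * (t * (u * v + d)), v, u₁ + s * (u₁ * v₁ + d₁),
        v₁ + s * (β * (v ^ 2 * t * t ^ β - v₁ ^ 2))) (t + s * (t * (v * t - v₁)))) 0 0 := by
  have hW' := hasDerivAt_sub_mul_rpow_second (β := β) (v := v) (v₁ := v₁) ht
  have hw := hasDerivAt_abs_rpow_comp ((1 - β) * β⁻¹) hW' (by simpa using hW)
  have hu₁ := hasDerivAt_add_mul u₁ (u₁ * v₁ + d₁)
  have h := hasDerivAt_add_mul t (t * (v * t - v₁))
  have hp := hasDerivAt_rpow_comp (β - 1) h (by simpa using ht)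
  have := hw.mul (((hp.const_mul d₁).sub_const d₁).add ((hu₁.const_mul (β - 1)).mul hW'))
  refine this.congr_deriv ?_
  simp only [Pi.add_apply, Pi.mul_apply, zero_mul, add_zero, Real.rpow_sub_one ht]
  field_simp
  ring

end SecondField

/-! ### The characteristic equations -/

/-- The two first-order equations on `𝒟` that are equivalent to the invariance of `J₃`. -/
structure CharEqAt (β d d₁ : ℝ) (𝒟 : Base → ℝ) (q : Base) : Prop where
  first : fderiv ℝ 𝒟 q (0, 1, 0, 𝒟 q ^ β) = 0
  second : fderiv ℝ 𝒟 q (𝒟 q * (q.1 * q.2.1 + d), 0, q.2.2.1 * q.2.2.2 + d₁,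
    β * (q.2.1 ^ 2 * 𝒟 q * 𝒟 q ^ β - q.2.2.2 ^ 2)) = 𝒟 q * (q.2.1 * 𝒟 q - q.2.2.2)

/-- A field annihilating an implicit equation of `𝒟` is tangent to the graph of `𝒟`. -/
theorem fderiv_eq_of_implicit {N : Base × ℝ → ℝ} {𝒟 : Base → ℝ} {q : Base}
    (hN : DifferentiableAt ℝ N (q, 𝒟 q)) (h𝒟 : DifferentiableAt ℝ 𝒟 q)
    (h0 : ∀ᶠ p in 𝓝 q, N (p, 𝒟 p) = 0) (h1 : deriv (fun t => N (q, t)) (𝒟 q) ≠ 0)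
    {ξ : Base} {η : ℝ} (hξ : HasDerivAt (fun s : ℝ => N (q + s • ξ, 𝒟 q + s * η)) 0 0) :
    fderiv ℝ 𝒟 q ξ = η := by
  set N' := fderiv ℝ N (q, 𝒟 q)
  have e1 : N' (ξ, η) = 0 := by
    have hc : HasDerivAt (fun s : ℝ => (q + s • ξ, 𝒟 q + s * η)) (ξ, η) 0 := by
      refine HasDerivAt.prodMk ?_ (hasDerivAt_add_mul _ _)
      simpa using ((hasDerivAt_id (0 : ℝ)).smul_const ξ).const_add q
    have hN' : HasFDerivAt N N' (q + (0 : ℝ) • ξ, 𝒟 q + 0 * η) := by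
      simpa using hN.hasFDerivAt
    exact (hN'.comp_hasDerivAt (0 : ℝ) hc).unique hξ
  have e2 : N' (ξ, fderiv ℝ 𝒟 q ξ) = 0 := by
    have hc : HasFDerivAt (fun p => (p, 𝒟 p))
        ((ContinuousLinearMap.id ℝ Base).prod (fderiv ℝ 𝒟 q)) q :=
      (hasFDerivAt_id q).prodMk h𝒟.hasFDerivAt
    have h := hN.hasFDerivAt.comp q hc
    have h' : HasFDerivAt (fun p => N (p, 𝒟 p)) (0 : Base →L[ℝ] ℝ) q :=
      (hasFDerivAt_const (0 : ℝ) q).congr_of_eventuallyEq h0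
    have := congrArg (fun l : Base →L[ℝ] ℝ => l ξ) (h.unique h')
    simpa using this
  have e3 : N' ((0 : Base), (1 : ℝ)) = deriv (fun t => N (q, t)) (𝒟 q) := by
    have hc : HasDerivAt (fun t : ℝ => (q, t)) ((0 : Base), (1 : ℝ)) (𝒟 q) :=
      (hasDerivAt_const _ q).prodMk (hasDerivAt_id _)
    exact ((hN.hasFDerivAt.comp_hasDerivAt (𝒟 q) hc).deriv).symm
  -- Both vectors lie in the kernel of `N'`. Their difference is vertical, and `N'` does not vanish
  -- in the vertical direction.
  have e4 : N' (ξ, fderiv ℝ 𝒟 q ξ) - N' (ξ, η) = (fderiv ℝ 𝒟 q ξ - η) * N' ((0 : Base), (1 : ℝ)) := by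
    rw [← map_sub, ← smul_eq_mul, ← map_smul]
    simp
  rw [e1, e2, e3, sub_zero] at e4
  have := (mul_eq_zero.1 e4.symm).resolve_right h1
  linarith

/-- Both fields annihilate K₃ and L₃, hence every differentiable function of them. -/
theorem charEqAt_of_givenImplicitlyAt {β d d₁ : ℝ} (hβ : β ≠ 0) {𝒟 : Base → ℝ} {q : Base}
    (h𝒟 : DifferentiableAt ℝ 𝒟 q) (hq : 𝒟 q ≠ 0) (hW : q.2.2.2 - q.2.1 * 𝒟 q ^ β ≠ 0)
    (h : GivenImplicitlyAt β d d₁ 𝒟 q) : CharEqAt β d d₁ 𝒟 q := by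
  obtain ⟨H, hH, hev⟩ := h
  obtain ⟨u, v, u₁, v₁⟩ := q
  set q : Base := (u, v, u₁, v₁) with hqdef
  set t := 𝒟 q with htdef
  have hKL : DifferentiableAt ℝ (fun z : Base × ℝ => (K₃ β d d₁ z.1 z.2, L₃ β d₁ z.1 z.2))
      (q, t) :=
    ((contDiffAt_K₃ β d d₁ (z := (q, t)) hq hW).differentiableAt (by simp)).prodMk
      ((contDiffAt_L₃ β d₁ (z := (q, t)) hq hW).differentiableAt (by simp))
  have hHd : Differentiable ℝ H := hH.differentiable (by simp)
  have hN : DifferentiableAt ℝ (fun z : Base × ℝ => H (K₃ β d d₁ z.1 z.2, L₃ β d₁ z.1 z.2))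
      (q, t) := (hHd _).comp (q, t) hKL
  have key := @fderiv_eq_of_implicit _ 𝒟 q hN h𝒟 (hev.mono fun p hp => hp.1) hev.self_of_nhds.2
  constructor
  · refine key (η := 0) ?_
    have : (fun s : ℝ => H (K₃ β d d₁ (q + s • ((0, 1, 0, t ^ β) : Base)) (t + s * 0),
        L₃ β d₁ (q + s • ((0, 1, 0, t ^ β) : Base)) (t + s * 0)))
        = fun _ => H (K₃ β d d₁ q t, L₃ β d₁ q t) := by
      funext s
      have e : q + s • ((0, 1, 0, t ^ β) : Base) = (u, v + s, u₁, v₁ + s * t ^ β) := by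
        simp [hqdef]
      rw [e, mul_zero, add_zero, K₃_add_first, L₃_add_first]
    exact this ▸ hasDerivAt_const (0 : ℝ) _
  · refine key (η := t * (v * t - v₁)) ?_
    have hK := hasDerivAt_K₃_second (d := d) (d₁ := d₁) (u := u) (u₁ := u₁) hβ hq hW
    have hL := hasDerivAt_L₃_second (d := d) (d₁ := d₁) (u := u) (u₁ := u₁) hβ hq hW
    have hc := (hHd _).hasFDerivAt.comp_hasDerivAt (0 : ℝ) (hK.prodMk hL)
    refine (hc.congr_deriv (map_zero _)).congr_of_eventuallyEq (Eventually.of_forall fun s => ?_)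
    simp [hqdef, htdef]

theorem System.isOpen_baseDom (S : System) (n : ℕ) : IsOpen (S.baseDom n) := by
  have h : (fun p : Args => p.2.1) = Prod.fst ∘ (Prod.snd : Args → Base × ℝ × ℝ) := rfl
  have ho : IsOpenMap (fun p : Args => p.2.1) := by
    rw [h]
    exact isOpenMap_fst.comp isOpenMap_snd
  exact ho _ (S.isOpen_dom n)

theorem eq_zero_of_frequently {X : Type*} [TopologicalSpace X] {G : X → ℝ} {q : X}
    (hG : ContinuousAt G q) (h : ∃ᶠ p in 𝓝 q, G p = 0) : G q = 0 := by
  by_contra h0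
  exact h (hG.eventually_ne h0)

theorem continuousAt_fderiv_of_contDiffAt {𝒟 : Base → ℝ} {q : Base} (h : ContDiffAt ℝ ∞ 𝒟 q) :
    ContinuousAt (fderiv ℝ 𝒟) q :=
  (h.fderiv_right (m := 0) (by simp)).continuousAt

/-- The characteristic equations hold where `𝒟` locally solves `v₁ = v 𝒟^β`. -/
theorem charEqAt_of_eventually_eq_zero {β d d₁ : ℝ} (hβ : β ≠ 0) {𝒟 : Base → ℝ} {q : Base}
    (h𝒟 : DifferentiableAt ℝ 𝒟 q) (hq : 𝒟 q ∈ powDom β)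
    (hW : ∀ᶠ p : Base in 𝓝 q, p.2.2.2 - p.2.1 * 𝒟 p ^ β = 0) : CharEqAt β d d₁ 𝒟 q := by
  have hq0 := ne_zero_of_mem_powDom hq
  have hqβ := rpow_ne_zero_of_mem_powDom hq
  -- If v = 0 at `q`, the relation forces v₁ = 0 on the whole line through `q` along which only v₁
  -- varies.
  have hv : q.2.1 ≠ 0 := by
    intro hv
    have hc : ContinuousAt (fun s : ℝ => ((q.1, q.2.1, q.2.2.1, q.2.2.2 + s) : Base)) 0 := by
      fun_prop
    have hev := hc.tendsto.eventually (p := fun p : Base => p.2.2.2 - p.2.1 * 𝒟 p ^ β = 0)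
      (by simpa using hW)
    have hne : ∃ᶠ s in 𝓝 (0 : ℝ), s ≠ 0 := by
      have : NeBot (𝓝[≠] (0 : ℝ)) := inferInstance
      exact (frequently_iff_neBot.2 this)
    obtain ⟨s, hs, hs0⟩ := (hev.and_frequently hne).exists
    have h0 := hW.self_of_nhds
    simp only [hv, zero_mul, sub_zero] at hs h0
    rw [h0, zero_add] at hs
    exact hs0 hs
  have hNc : ContDiffAt ℝ ∞ (fun z : Base × ℝ => z.1.2.2.2 - z.1.2.1 * z.2 ^ β) (q, 𝒟 q) :=
    contDiffAt_sub_mul_rpow β hq0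
  have hder : deriv (fun t => q.2.2.2 - q.2.1 * t ^ β) (𝒟 q) ≠ 0 := by
    have := ((hasDerivAt_rpow_comp β (hasDerivAt_id (𝒟 q)) hq0).const_mul q.2.1).const_sub
      q.2.2.2
    simp only [id_eq] at this
    rw [this.deriv]
    simp only [mul_one, ne_eq, neg_eq_zero, mul_eq_zero, div_eq_zero_iff, hβ, hqβ, hq0, hv,
      or_self, not_false_eq_true]
  have key := @fderiv_eq_of_implicit _ 𝒟 q (hNc.differentiableAt (by simp)) h𝒟 hW hder
  have h0 := hW.self_of_nhds
  obtain ⟨u, v, u₁, v₁⟩ := q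
  constructor
  · refine key (η := 0) ?_
    refine (hasDerivAt_const (0 : ℝ) (0 : ℝ)).congr_of_eventuallyEq
      (Eventually.of_forall fun s => ?_)
    simp only [Prod.smul_mk, Prod.mk_add_mk, smul_eq_mul, mul_zero, add_zero, mul_one] at h0 ⊢
    linear_combination h0
  · refine key ?_
    have h := hasDerivAt_sub_mul_rpow_second (β := β) (v := v) (v₁ := v₁) hq0
    simp only at h0
    refine (h.congr_deriv (by rw [h0, mul_zero])).congr_of_eventuallyEq
      (Eventually.of_forall fun s => ?_)
    simp

/-- If the characteristic equations hold at the points near `q` with `v₁ ≠ v 𝒟^β`, then they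
hold at `q`. -/
theorem charEqAt_of_eventually {β d d₁ : ℝ} (hβ : β ≠ 0) {𝒟 : Base → ℝ} {q : Base}
    (h𝒟 : ContDiffAt ℝ ∞ 𝒟 q) (hq : 𝒟 q ∈ powDom β)
    (h : ∀ᶠ p : Base in 𝓝 q, p.2.2.2 - p.2.1 * 𝒟 p ^ β ≠ 0 → CharEqAt β d d₁ 𝒟 p) :
    CharEqAt β d d₁ 𝒟 q := by
  by_cases hW : ∀ᶠ p : Base in 𝓝 q, p.2.2.2 - p.2.1 * 𝒟 p ^ β = 0
  · exact charEqAt_of_eventually_eq_zero hβ (h𝒟.differentiableAt (by simp)) hq hW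
  -- Otherwise points with W ≠ 0 accumulate at `q`, and both equations, continuous in the point,
  -- pass to the limit.
  have hf : ∃ᶠ p : Base in 𝓝 q, CharEqAt β d d₁ 𝒟 p :=
    (h.and_frequently (not_eventually.1 hW)).mono fun p hp => hp.1 hp.2
  have h1 := continuousAt_fderiv_of_contDiffAt h𝒟
  have h2 : ContinuousAt 𝒟 q := h𝒟.continuousAt
  have h3 : ContinuousAt (fun p => 𝒟 p ^ β) q :=
    h2.rpow_const (Or.inl (ne_zero_of_mem_powDom hq))
  constructor
  · refine eq_zero_of_frequently (G := fun p => fderiv ℝ 𝒟 p (0, 1, 0, 𝒟 p ^ β)) ?_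
      (hf.mono fun p hp => hp.first)
    exact h1.clm_apply (by fun_prop)
  · have := eq_zero_of_frequently (q := q) (G := fun p : Base => fderiv ℝ 𝒟 p
      (𝒟 p * (p.1 * p.2.1 + d), 0, p.2.2.1 * p.2.2.2 + d₁,
        β * (p.2.1 ^ 2 * 𝒟 p * 𝒟 p ^ β - p.2.2.2 ^ 2)) - 𝒟 p * (p.2.1 * 𝒟 p - p.2.2.2)) ?_
      (hf.mono fun p hp => sub_eq_zero.2 hp.second)
    · exact sub_eq_zero.1 this
    · exact (h1.clm_apply (by fun_prop)).sub (by fun_prop)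

/-! ### From the form of the system to the two integrals -/

section Form

variable {S : System} {β : ℝ} {d : ℕ → ℝ}

theorem System.HasForm₃.isNIntegral_I₃ (hS : S.Admissible β d) (h : S.HasForm₃ β d) :
    S.IsNIntegral (I₃ β d) := by
  intro a b m M u v hsol n hmn hnM x hx
  obtain ⟨hdom, hu, hv⟩ := hsol.2 n hmn hnM x hx
  obtain ⟨𝒟, -, hpow, hform, -⟩ := h n
  obtain ⟨hux, hA, hA₁⟩ := hS n _ _ _ _ _ _ _ hdom
  obtain ⟨hf, hg⟩ := hform _ _ _ _ _ _ _ hdom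
  have ht := hpow _ ⟨_, hdom, rfl⟩
  simp only at ht
  rw [hf] at hu
  rw [hg] at hv
  generalize 𝒟 (u n x, v n x, u (n + 1) x, v (n + 1) x) = t at *
  have hmem : deriv (u (n + 1)) x ∈ powDom β := by
    rw [hu]
    exact mul_mem_powDom (div_mem_powDom hA₁ (mul_mem_powDom ht hA)) hux
  refine ⟨⟨hux, hA⟩, ⟨hmem, hA₁⟩, ?_⟩
  simp only [I₃, jet]
  rw [Real.rpow_add_one (ne_zero_of_mem_powDom hmem),
    Real.rpow_add_one (ne_zero_of_mem_powDom hux), Real.rpow_add_one (ne_zero_of_mem_powDom hA),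
    Real.rpow_add_one (ne_zero_of_mem_powDom hA₁), hv]
  have e : deriv (u (n + 1)) x ^ β =
      (u (n + 1) x * v (n + 1) x + d (n + 1)) ^ β / (t ^ β * (u n x * v n x + d n) ^ β)
        * deriv (u n) x ^ β := by
    rw [hu, mul_rpow_of_mem_powDom (div_mem_powDom hA₁ (mul_mem_powDom ht hA)) hux,
      div_rpow_of_mem_powDom hA₁ (mul_mem_powDom ht hA), mul_rpow_of_mem_powDom ht hA]
  rw [e, hu]
  have n1 := ne_zero_of_mem_powDom hA
  have n2 := ne_zero_of_mem_powDom hA₁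
  have n3 := ne_zero_of_mem_powDom ht
  have n4 := rpow_ne_zero_of_mem_powDom hA
  have n5 := rpow_ne_zero_of_mem_powDom hA₁
  have n6 := rpow_ne_zero_of_mem_powDom ht
  field_simp
  ring

theorem System.charEqAt_of_implicit (hβ : β ≠ 0) {n : ℕ} {𝒟 : Base → ℝ}
    (h𝒟 : ContDiffOn ℝ ∞ 𝒟 (S.baseDom n)) (hpow : ∀ q ∈ S.baseDom n, 𝒟 q ∈ powDom β)
    (h : ∀ u v u₁ v₁, (u, v, u₁, v₁) ∈ S.baseDom n →
      v₁ - v * 𝒟 (u, v, u₁, v₁) ^ β = 0 ∨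
        GivenImplicitlyAt β (d n) (d (n + 1)) 𝒟 (u, v, u₁, v₁)) {q : Base}
    (hq : q ∈ S.baseDom n) : CharEqAt β (d n) (d (n + 1)) 𝒟 q := by
  have hB := S.isOpen_baseDom n
  refine charEqAt_of_eventually hβ (h𝒟.contDiffAt (hB.mem_nhds hq)) (hpow q hq) ?_
  filter_upwards [hB.mem_nhds hq] with p hp hW
  exact charEqAt_of_givenImplicitlyAt hβ
    ((h𝒟.contDiffAt (hB.mem_nhds hp)).differentiableAt (by simp))
    (ne_zero_of_mem_powDom (hpow p hp)) hW ((h _ _ _ _ hp).resolve_left hW)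

/-- The components of a solution have second derivatives. -/
theorem System.IsSolution.hasDerivAt {a b : ℝ} {m M : ℕ} {u v : ℕ → ℝ → ℝ}
    (hsol : S.IsSolution a b m M u v) {n : ℕ} (hmn : m ≤ n) (hnM : n ≤ M) {x : ℝ}
    (hx : x ∈ Set.Ioo a b) :
    (HasDerivAt (u n) (deriv (u n) x) x ∧ HasDerivAt (deriv (u n)) (deriv (deriv (u n)) x) x) ∧
      HasDerivAt (v n) (deriv (v n) x) x ∧ HasDerivAt (deriv (v n)) (deriv (deriv (v n)) x) x := by
  have aux : ∀ w : ℝ → ℝ, ContDiffOn ℝ 2 w (Set.Ioo a b) →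
      HasDerivAt w (deriv w x) x ∧ HasDerivAt (deriv w) (deriv (deriv w) x) x := fun w hw => by
    rw [show (2 : WithTop ℕ∞) = 1 + 1 by norm_num,
      contDiffOn_succ_iff_deriv_of_isOpen isOpen_Ioo] at hw
    exact ⟨(hw.1.differentiableAt (isOpen_Ioo.mem_nhds hx)).hasDerivAt,
      ((hw.2.2.differentiableOn (by simp)).differentiableAt (isOpen_Ioo.mem_nhds hx)).hasDerivAt⟩
  exact ⟨aux _ (hsol.1 n hmn hnM).1, aux _ (hsol.1 n hmn hnM).2⟩

theorem System.HasForm₃.isNIntegral_J₃ (hβ : β ≠ 0) (hS : S.Admissible β d)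
    (h : S.HasForm₃ β d) : S.IsNIntegral (J₃ d) := by
  intro a b m M u v hsol n hmn hnM x hx
  obtain ⟨hdom, hu, hv⟩ := hsol.2 n hmn hnM x hx
  obtain ⟨𝒟, h𝒟, hpow, hform, himp⟩ := h n
  obtain ⟨hux, hA, hA₁⟩ := hS n _ _ _ _ _ _ _ hdom
  obtain ⟨hf, hg⟩ := hform _ _ _ _ _ _ _ hdom
  obtain ⟨⟨du, ddu⟩, dv, -⟩ := hsol.hasDerivAt hmn hnM.le hx
  obtain ⟨⟨du₁, -⟩, dv₁, -⟩ := hsol.hasDerivAt (by omega : m ≤ n + 1) hnM hx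
  have hqB : (u n x, v n x, u (n + 1) x, v (n + 1) x) ∈ S.baseDom n := ⟨_, hdom, rfl⟩
  have ht := ne_zero_of_mem_powDom (hpow _ hqB)
  obtain ⟨c1, c2⟩ := System.charEqAt_of_implicit hβ h𝒟 hpow himp hqB
  have hux0 := ne_zero_of_mem_powDom hux
  have hA0 := ne_zero_of_mem_powDom hA
  have hA₁0 := ne_zero_of_mem_powDom hA₁
  rw [hf] at hu
  rw [hg] at hv
  have hD : HasDerivAt (fun y => 𝒟 (u n y, v n y, u (n + 1) y, v (n + 1) y)) _ x :=
    ((h𝒟.contDiffAt ((S.isOpen_baseDom n).mem_nhds hqB)).differentiableAt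
      (by simp)).hasFDerivAt.comp_hasDerivAt x (hasDerivAt_base du dv du₁ dv₁)
  have hev : deriv (u (n + 1)) =ᶠ[𝓝 x] fun y =>
      (u (n + 1) y * v (n + 1) y + d (n + 1)) /
        (𝒟 (u n y, v n y, u (n + 1) y, v (n + 1) y) * (u n y * v n y + d n)) * deriv (u n) y := by
    filter_upwards [isOpen_Ioo.mem_nhds hx] with y hy
    obtain ⟨hdom', hu', -⟩ := hsol.2 n hmn hnM y hy
    rw [hu', (hform _ _ _ _ _ _ _ hdom').1]
  have hdd := ((((du₁.mul dv₁).add_const (d (n + 1))).div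
    (hD.mul ((du.mul dv).add_const (d n))) (mul_ne_zero ht hA0)).mul ddu)
  have hdd' := (hdd.congr_of_eventuallyEq hev).deriv
  set q : Base := (u n x, v n x, u (n + 1) x, v (n + 1) x) with hqdef
  change fderiv ℝ 𝒟 q (𝒟 q * (u n x * v n x + d n), 0, u (n + 1) x * v (n + 1) x + d (n + 1),
    β * (v n x ^ 2 * 𝒟 q * 𝒟 q ^ β - v (n + 1) x ^ 2))
      = 𝒟 q * (v n x * 𝒟 q - v (n + 1) x) at c2
  have hδ : fderiv ℝ 𝒟 q (deriv (u n) x, deriv (v n) x, deriv (u (n + 1)) x, deriv (v (n + 1)) x)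
      = deriv (u n) x * (v n x * 𝒟 q - v (n + 1) x) / (u n x * v n x + d n) := by
    -- Along a solution, (u, v, u₁, v₁) moves in the span of the two characteristic directions, so
    -- the two equations determine the x-derivative of 𝒟.
    have e : ((deriv (u n) x, deriv (v n) x, deriv (u (n + 1)) x, deriv (v (n + 1)) x) : Base)
        = (deriv (u n) x / (𝒟 q * (u n x * v n x + d n))) • ((𝒟 q * (u n x * v n x + d n), 0,
            u (n + 1) x * v (n + 1) x + d (n + 1),
            β * (v n x ^ 2 * 𝒟 q * 𝒟 q ^ β - v (n + 1) x ^ 2)) : Base)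
          + deriv (v n) x • ((0, 1, 0, 𝒟 q ^ β) : Base) := by
      rw [hu, hv]
      simp only [Prod.smul_mk, Prod.mk_add_mk, smul_eq_mul, Prod.mk.injEq]
      refine ⟨?_, ?_, ?_, ?_⟩ <;> field_simp <;> ring
    rw [e, map_add, map_smul, map_smul, c1, c2]
    simp only [smul_eq_mul]
    field_simp
    ring
  have hne : deriv (u (n + 1)) x ≠ 0 := by
    rw [hu]
    exact mul_ne_zero (div_ne_zero hA₁0 (mul_ne_zero ht hA0)) hux0
  refine ⟨⟨hux0, hA0⟩, ⟨hne, hA₁0⟩, ?_⟩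
  simp only [J₃, jet]
  rw [hdd', hδ]
  simp only [Pi.mul_apply, Pi.div_apply]
  rw [← hqdef, hv, hu]
  field_simp
  ring

end Form

/-! ### Existence of local solutions with a prescribed jet -/

theorem two_le_infty : (2 : WithTop ℕ∞) ≤ ∞ := by
  rw [show (2 : WithTop ℕ∞) = ((2 : ℕ∞) : WithTop ℕ∞) from rfl]
  exact_mod_cast le_top

/-- Integral curves of a `C¹` vector field are `C²`. -/
theorem contDiffOn_two_of_hasDerivAt {E : Type*} [NormedAddCommGroup E] [NormedSpace ℝ E]
    {V : E → E} {O : Set E} (hV : ContDiffOn ℝ 1 V O) {I : Set ℝ} (hI : IsOpen I) {α : ℝ → E}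
    (hα : ∀ t ∈ I, HasDerivAt α (V (α t)) t) (hO : Set.MapsTo α I O) : ContDiffOn ℝ 2 α I := by
  have hd : DifferentiableOn ℝ α I := fun t ht => (hα t ht).differentiableAt.differentiableWithinAt
  -- Bootstrap: the derivative of `α` is `V ∘ α`, so `α` gains one order of smoothness as long as
  -- `V` allows it.
  have step : ∀ k : WithTop ℕ∞, k ≤ 1 → ContDiffOn ℝ k α I → ContDiffOn ℝ (k + 1) α I := by
    intro k hk h
    refine (contDiffOn_succ_iff_deriv_of_isOpen hI).2 ⟨hd, ?_, ?_⟩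
    · rintro rfl
      exact absurd hk (by simp)
    · exact ((hV.of_le hk).comp h hO).congr fun t ht => (hα t ht).deriv
  have h1 : ContDiffOn ℝ 1 α I := by
    simpa using step 0 (by simp) (contDiffOn_zero.2 hd.continuousOn)
  rw [show (2 : WithTop ℕ∞) = 1 + 1 by norm_num]
  exact step 1 le_rfl h1

/-- The quadratic polynomial with a prescribed second-order jet at `x₀`. -/
def quadratic (x₀ a b c : ℝ) (x : ℝ) : ℝ := a + b * (x - x₀) + c / 2 * (x - x₀) ^ 2

theorem contDiff_quadratic (x₀ a b c : ℝ) : ContDiff ℝ ∞ (quadratic x₀ a b c) := by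
  unfold quadratic
  fun_prop

theorem deriv_quadratic (x₀ a b c : ℝ) :
    deriv (quadratic x₀ a b c) = fun x => b + c * (x - x₀) := by
  funext x
  have h1 : HasDerivAt (fun x => x - x₀) 1 x := (hasDerivAt_id x).sub_const x₀
  have h := ((h1.const_mul b).const_add a).add ((h1.pow 2).const_mul (c / 2))
  refine (h.congr_deriv ?_).deriv
  simp
  ring

theorem deriv_deriv_quadratic (x₀ a b c : ℝ) :
    deriv (deriv (quadratic x₀ a b c)) = fun _ => c := by
  rw [deriv_quadratic]
  funext x
  simp

/-- Through every point of the domain there passes a local solution, with arbitrary second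
derivatives of `u` and `v` at that point. -/
theorem System.exists_isSolution (S : System) (n : ℕ) {x₀ u v u₁ v₁ ux vx : ℝ}
    (h : (x₀, (u, v, u₁, v₁), ux, vx) ∈ S.dom n) (uxx vxx : ℝ) :
    ∃ (a b : ℝ) (U V : ℕ → ℝ → ℝ), x₀ ∈ Set.Ioo a b ∧ S.IsSolution a b n (n + 1) U V ∧
      U n x₀ = u ∧ V n x₀ = v ∧ U (n + 1) x₀ = u₁ ∧ V (n + 1) x₀ = v₁ ∧
      deriv (U n) x₀ = ux ∧ deriv (V n) x₀ = vx ∧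
      deriv (deriv (U n)) x₀ = uxx ∧ deriv (deriv (V n)) x₀ = vxx := by
  -- The functions at level `n` can be chosen freely. With them fixed, the system is an ODE for (u₁,
  -- v₁), made autonomous by taking x as an extra coordinate of speed 1.
  set p := quadratic x₀ u ux uxx with hp
  set r := quadratic x₀ v vx vxx with hr
  have hpc : ContDiff ℝ ∞ p := contDiff_quadratic _ _ _ _
  have hrc : ContDiff ℝ ∞ r := contDiff_quadratic _ _ _ _
  have hpc' : ContDiff ℝ ∞ (deriv p) := by
    rw [hp, deriv_quadratic]
    fun_prop
  have hrc' : ContDiff ℝ ∞ (deriv r) := by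
    rw [hr, deriv_quadratic]
    fun_prop
  set Γ : ℝ × ℝ × ℝ → Args :=
    fun z => (z.1, (p z.1, r z.1, z.2.1, z.2.2), deriv p z.1, deriv r z.1) with hΓ
  have hΓc : ContDiff ℝ ∞ Γ := by
    rw [hΓ]
    fun_prop
  set O : Set (ℝ × ℝ × ℝ) := Γ ⁻¹' S.dom n with hO
  have hOo : IsOpen O := (S.isOpen_dom n).preimage hΓc.continuous
  set F : ℝ × ℝ × ℝ → ℝ × ℝ × ℝ := fun z => (1, S.f n (Γ z), S.g n (Γ z)) with hF
  have hFc : ContDiffOn ℝ ∞ F O :=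
    contDiffOn_const.prodMk
      (((S.smooth_f n).comp hΓc.contDiffOn fun _ hz => hz).prodMk
        ((S.smooth_g n).comp hΓc.contDiffOn fun _ hz => hz))
  have hFc1 : ContDiffOn ℝ 1 F O := hFc.of_le (by exact_mod_cast le_top)
  have hz₀ : ((x₀, u₁, v₁) : ℝ × ℝ × ℝ) ∈ O := by
    change Γ (x₀, u₁, v₁) ∈ S.dom n
    simpa [hΓ, hp, hr, deriv_quadratic, quadratic] using h
  obtain ⟨ρ, hρ, ε, hε, hex⟩ :=
    (hFc1.contDiffAt
      (hOo.mem_nhds hz₀)).exists_forall_mem_closedBall_exists_eq_forall_mem_Ioo_hasDerivAt x₀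
  obtain ⟨α, hα0, hα⟩ := hex _ (Metric.mem_closedBall_self hρ.le)
  have hx₀ : x₀ ∈ Set.Ioo (x₀ - ε) (x₀ + ε) := ⟨by linarith, by linarith⟩
  have hfst : ∀ t ∈ Set.Ioo (x₀ - ε) (x₀ + ε), (α t).1 = t := by
    intro t ht
    have hd : ∀ s ∈ Set.Ioo (x₀ - ε) (x₀ + ε), HasDerivAt (fun s => (α s).1 - s) 0 s := by
      intro s hs
      have h1 : HasDerivAt (fun s => (α s).1) 1 s := (hα s hs).fst
      exact (h1.sub (hasDerivAt_id s)).congr_deriv (sub_self 1)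
    have := isOpen_Ioo.is_const_of_deriv_eq_zero isPreconnected_Ioo
      (fun s hs => (hd s hs).differentiableAt.differentiableWithinAt)
      (fun s hs => (hd s hs).deriv) ht hx₀
    simp only [hα0, sub_self] at this
    linarith
  have hev : ∀ᶠ t in 𝓝 x₀, t ∈ Set.Ioo (x₀ - ε) (x₀ + ε) ∧ α t ∈ O := by
    refine (isOpen_Ioo.eventually_mem hx₀).and ?_
    exact (hα x₀ hx₀).continuousAt.eventually_mem (hα0 ▸ hOo.mem_nhds hz₀)
  obtain ⟨δ, hδ, hball⟩ := Metric.eventually_nhds_iff_ball.1 hev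
  rw [Real.ball_eq_Ioo] at hball
  have hα2 : ContDiffOn ℝ 2 α (Set.Ioo (x₀ - δ) (x₀ + δ)) :=
    contDiffOn_two_of_hasDerivAt hFc1 isOpen_Ioo (fun t ht => hα t (hball t ht).1)
      fun t ht => (hball t ht).2
  refine ⟨x₀ - δ, x₀ + δ, fun k => if k = n then p else fun t => (α t).2.1,
    fun k => if k = n then r else fun t => (α t).2.2, ⟨by linarith, by linarith⟩, ⟨?_, ?_⟩, ?_⟩
  · intro k _ _
    by_cases hk : k = n
    · simp only [hk, if_true]
      exact ⟨(hpc.of_le two_le_infty).contDiffOn, (hrc.of_le two_le_infty).contDiffOn⟩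
    · simp only [hk, if_false]
      exact ⟨contDiff_fst.comp_contDiffOn (contDiff_snd.comp_contDiffOn hα2),
        contDiff_snd.comp_contDiffOn (contDiff_snd.comp_contDiffOn hα2)⟩
  · intro k hk hk' x hx
    obtain rfl : k = n := by omega
    have hk1 : k + 1 ≠ k := by omega
    simp only [hk1, if_true, if_false]
    have hΓx : (x, (p x, r x, (α x).2.1, (α x).2.2), deriv p x, deriv r x) = Γ (α x) := by
      simp only [hΓ, hfst x (hball x hx).1]
    rw [hΓx]
    have hd := hα x (hball x hx).1
    have h1 : HasDerivAt (fun t => (α t).2.1) (S.f k (Γ (α x))) x := hd.snd.fst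
    have h2 : HasDerivAt (fun t => (α t).2.2) (S.g k (Γ (α x))) x := hd.snd.snd
    exact ⟨(hball x hx).2, h1.deriv, h2.deriv⟩
  · have hk1 : n + 1 ≠ n := by omega
    simp only [hk1, if_true, if_false, hα0]
    simp [hp, hr, deriv_deriv_quadratic]
    simp [deriv_quadratic, quadratic]

/-! ### From the two integrals to the form of the system -/

/-- The value that `𝒟` must have for the first equation of the system to have the form
`u₁ₓ = (u₁v₁+d₁) / (𝒟 (uv+d)) uₓ`. -/
def System.quot (S : System) (d : ℕ → ℝ) (n : ℕ) (y : Args) : ℝ :=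
  (y.2.1.2.2.1 * y.2.1.2.2.2 + d (n + 1)) * y.2.2.1
    / ((y.2.1.1 * y.2.1.2.1 + d n) * S.f n y)

/-- Comparing the value at `w₀` with the values at one shift in each coordinate isolates the
coefficients. -/
theorem affine_eq_zero {c₀ c₁ c₂ : ℝ} {w₀ : ℝ × ℝ}
    (h : ∀ᶠ w in 𝓝 w₀, c₀ + w.1 * c₁ + w.2 * c₂ = 0) : c₀ = 0 ∧ c₁ = 0 ∧ c₂ = 0 := by
  obtain ⟨r, hr, hball⟩ := Metric.eventually_nhds_iff_ball.1 h
  have hr2 : |r / 2| < r := by rw [abs_of_pos (by linarith)]; linarith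
  have h0 := hball w₀ (Metric.mem_ball_self hr)
  have h1 := hball (w₀.1 + r / 2, w₀.2) (by
    simp only [Metric.mem_ball, Prod.dist_eq, Real.dist_eq, add_sub_cancel_left, sub_self,
      abs_zero, max_lt_iff]
    exact ⟨hr2, hr⟩)
  have h2 := hball (w₀.1, w₀.2 + r / 2) (by
    simp only [Metric.mem_ball, Prod.dist_eq, Real.dist_eq, add_sub_cancel_left, sub_self,
      abs_zero, max_lt_iff]
    exact ⟨hr, hr2⟩)
  simp only at h1 h2
  have e1 : r / 2 * c₁ = 0 := by linear_combination h1 - h0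
  have e2 : r / 2 * c₂ = 0 := by linear_combination h2 - h0
  have hr0 : r / 2 ≠ 0 := by positivity
  have e1' := (mul_eq_zero.1 e1).resolve_left hr0
  have e2' := (mul_eq_zero.1 e2).resolve_left hr0
  refine ⟨?_, e1', e2'⟩
  simpa [e1', e2'] using h0

section Integrals

variable {S : System} {β : ℝ} {d : ℕ → ℝ} {n : ℕ}

/-- This comes from the requirement that I₃ be defined at n + 1 as well, where uₓ becomes `f`. -/
theorem System.f_mem_powDom (hI : S.IsNIntegral (I₃ β d)) {y : Args} (hy : y ∈ S.dom n) :
    S.f n y ∈ powDom β := by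
  obtain ⟨x, ⟨u, v, u₁, v₁⟩, ux, vx⟩ := y
  obtain ⟨a, b, U, V, hx, hsol, rfl, rfl, rfl, rfl, rfl, rfl, -, -⟩ := S.exists_isSolution n hy 0 0
  rw [← (hsol.2 n le_rfl n.lt_succ_self x hx).2.1]
  exact (hI a b n (n + 1) U V hsol n le_rfl n.lt_succ_self x hx).2.1.1

theorem System.quot_mem_powDom (hS : S.Admissible β d) (hI : S.IsNIntegral (I₃ β d)) {y : Args}
    (hy : y ∈ S.dom n) : S.quot d n y ∈ powDom β := by
  obtain ⟨hux, hA, hA₁⟩ := hS n _ _ _ _ _ _ _ hy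
  exact div_mem_powDom (mul_mem_powDom hA₁ hux) (mul_mem_powDom hA (S.f_mem_powDom hI hy))

theorem System.contDiffAt_quot (hS : S.Admissible β d) (hI : S.IsNIntegral (I₃ β d)) {y : Args}
    (hy : y ∈ S.dom n) : ContDiffAt ℝ ∞ (S.quot d n) y := by
  obtain ⟨-, hA, -⟩ := hS n _ _ _ _ _ _ _ hy
  have hf : ContDiffAt ℝ ∞ (S.f n) y := (S.smooth_f n).contDiffAt ((S.isOpen_dom n).mem_nhds hy)
  unfold System.quot
  refine ContDiffAt.div (by fun_prop) (by fun_prop) ?_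
  exact mul_ne_zero (ne_zero_of_mem_powDom hA) (ne_zero_of_mem_powDom (S.f_mem_powDom hI hy))

theorem System.f_eq (hS : S.Admissible β d) (hI : S.IsNIntegral (I₃ β d)) {x u v u₁ v₁ ux vx : ℝ}
    (hy : (x, (u, v, u₁, v₁), ux, vx) ∈ S.dom n) :
    S.f n (x, (u, v, u₁, v₁), ux, vx) = (u₁ * v₁ + d (n + 1)) /
      (S.quot d n (x, (u, v, u₁, v₁), ux, vx) * (u * v + d n)) * ux := by
  obtain ⟨hux, hA, hA₁⟩ := hS n _ _ _ _ _ _ _ hy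
  have n1 := ne_zero_of_mem_powDom hA
  have n2 := ne_zero_of_mem_powDom hA₁
  have n3 := ne_zero_of_mem_powDom hux
  have n4 := ne_zero_of_mem_powDom (S.f_mem_powDom hI hy)
  simp only [System.quot]
  field_simp

/-- Invariance of I₃ is linear in `g` with nonzero coefficient f^β/(u₁v₁+d₁)^β; multiplicativity of
powers on `powDom` expresses that coefficient through t^β. -/
theorem System.g_eq (hS : S.Admissible β d) (hI : S.IsNIntegral (I₃ β d)) {x u v u₁ v₁ ux vx : ℝ}
    (hy : (x, (u, v, u₁, v₁), ux, vx) ∈ S.dom n) :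
    S.g n (x, (u, v, u₁, v₁), ux, vx) =
      (-β * v₁ ^ 2 / (S.quot d n (x, (u, v, u₁, v₁), ux, vx) * (u * v + d n))
        + β * v ^ 2 * S.quot d n (x, (u, v, u₁, v₁), ux, vx) ^ β / (u * v + d n)) * ux
        + S.quot d n (x, (u, v, u₁, v₁), ux, vx) ^ β * vx := by
  have hf := System.f_eq hS hI hy
  have ht := System.quot_mem_powDom hS hI hy
  have hfp := S.f_mem_powDom hI hy
  obtain ⟨hux, hA, hA₁⟩ := hS n _ _ _ _ _ _ _ hy
  have hint : S.f n (x, (u, v, u₁, v₁), ux, vx) ^ β * S.g n (x, (u, v, u₁, v₁), ux, vx)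
        / (u₁ * v₁ + d (n + 1)) ^ β
      + β * v₁ ^ 2 * S.f n (x, (u, v, u₁, v₁), ux, vx) ^ (β + 1)
        / (u₁ * v₁ + d (n + 1)) ^ (β + 1)
      = ux ^ β * vx / (u * v + d n) ^ β + β * v ^ 2 * ux ^ (β + 1) / (u * v + d n) ^ (β + 1) := by
    obtain ⟨a, b, U, V, hx, hsol, rfl, rfl, rfl, rfl, rfl, rfl, -, -⟩ :=
      S.exists_isSolution n hy 0 0
    rw [← (hsol.2 n le_rfl n.lt_succ_self x hx).2.1, ← (hsol.2 n le_rfl n.lt_succ_self x hx).2.2]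
    exact (hI a b n (n + 1) U V hsol n le_rfl n.lt_succ_self x hx).2.2
  generalize S.g n (x, (u, v, u₁, v₁), ux, vx) = G at *
  generalize S.f n (x, (u, v, u₁, v₁), ux, vx) = F at *
  generalize S.quot d n (x, (u, v, u₁, v₁), ux, vx) = t at *
  have n1 := ne_zero_of_mem_powDom hA
  have n2 := ne_zero_of_mem_powDom hA₁
  have n3 := ne_zero_of_mem_powDom ht
  have n7 := ne_zero_of_mem_powDom hux
  have n4 := rpow_ne_zero_of_mem_powDom hA
  have n5 := rpow_ne_zero_of_mem_powDom hA₁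
  have n6 := rpow_ne_zero_of_mem_powDom ht
  have n8 := rpow_ne_zero_of_mem_powDom hux
  rw [Real.rpow_add_one (ne_zero_of_mem_powDom hfp), Real.rpow_add_one n7, Real.rpow_add_one n1,
    Real.rpow_add_one n2, hf, mul_rpow_of_mem_powDom (div_mem_powDom hA₁ (mul_mem_powDom ht hA)) hux,
    div_rpow_of_mem_powDom hA₁ (mul_mem_powDom ht hA), mul_rpow_of_mem_powDom ht hA] at hint
  generalize t ^ β = P at *
  generalize (u * v + d n) ^ β = Q at *
  generalize ux ^ β = R at *
  generalize (u₁ * v₁ + d (n + 1)) ^ β = T at *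
  generalize u * v + d n = A at *
  generalize u₁ * v₁ + d (n + 1) = A₁ at *
  field_simp at hint ⊢
  linear_combination hint

/-- On a solution, `quot` is (u₁v₁+d₁) uₓ / ((uv+d) u₁ₓ). Its logarithmic derivative contains uₓₓ/uₓ
- u₁ₓₓ/u₁ₓ, exactly the combination that invariance of J₃ expresses by first derivatives. -/
theorem System.fderiv_quot (hS : S.Admissible β d) (hI : S.IsNIntegral (I₃ β d))
    (hJ : S.IsNIntegral (J₃ d)) {x u v u₁ v₁ ux vx : ℝ}
    (hy : (x, (u, v, u₁, v₁), ux, vx) ∈ S.dom n) (uxx vxx : ℝ) :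
    fderiv ℝ (S.quot d n) (x, (u, v, u₁, v₁), ux, vx)
      (1, (ux, vx, S.f n (x, (u, v, u₁, v₁), ux, vx), S.g n (x, (u, v, u₁, v₁), ux, vx)),
        uxx, vxx)
      = ux * (v * S.quot d n (x, (u, v, u₁, v₁), ux, vx) - v₁) / (u * v + d n) := by
  have hq := (System.contDiffAt_quot hS hI hy).differentiableAt (by simp)
  have hf := S.f_mem_powDom hI hy
  obtain ⟨hux, hA, hA₁⟩ := hS n _ _ _ _ _ _ _ hy
  obtain ⟨a, b, U, V, hx, hsol, rfl, rfl, rfl, rfl, rfl, rfl, rfl, rfl⟩ :=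
    S.exists_isSolution n hy uxx vxx
  obtain ⟨-, hU, hV⟩ := hsol.2 n le_rfl n.lt_succ_self x hx
  obtain ⟨⟨du, ddu⟩, dv, ddv⟩ := hsol.hasDerivAt le_rfl n.le_succ hx
  obtain ⟨⟨du₁, ddu₁⟩, dv₁, -⟩ := hsol.hasDerivAt (n := n + 1) (by omega) le_rfl hx
  have hJ' := (hJ a b n (n + 1) U V hsol n le_rfl n.lt_succ_self x hx).2.2
  simp only [J₃, jet] at hJ'
  have hev : (fun y => S.quot d n (y, (U n y, V n y, U (n + 1) y, V (n + 1) y), deriv (U n) y,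
      deriv (V n) y)) =ᶠ[𝓝 x] fun y => (U (n + 1) y * V (n + 1) y + d (n + 1)) * deriv (U n) y
        / ((U n y * V n y + d n) * deriv (U (n + 1)) y) := by
    filter_upwards [isOpen_Ioo.mem_nhds hx] with y hy'
    rw [(hsol.2 n le_rfl n.lt_succ_self y hy').2.1]
    rfl
  have hcurve : HasDerivAt (fun y => ((y, (U n y, V n y, U (n + 1) y, V (n + 1) y),
      deriv (U n) y, deriv (V n) y) : Args)) _ x :=
    (hasDerivAt_id' x).prodMk ((hasDerivAt_base du dv du₁ dv₁).prodMk (ddu.prodMk ddv))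
  have hc := HasFDerivAt.comp_hasDerivAt (l := S.quot d n) x hq.hasFDerivAt hcurve
  rw [← hU] at hf
  rw [← hU, ← hV]
  have n1 := ne_zero_of_mem_powDom hA
  have n2 := ne_zero_of_mem_powDom hA₁
  have n3 := ne_zero_of_mem_powDom hux
  have n4 := ne_zero_of_mem_powDom hf
  have hd := ((((du₁.mul dv₁).add_const (d (n + 1))).mul ddu).div
    (((du.mul dv).add_const (d n)).mul ddu₁) (mul_ne_zero n1 n4))
  have hval := hev.self_of_nhds
  simp only at hval
  rw [hc.unique (hd.congr_of_eventuallyEq hev), hval]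
  simp only [Pi.mul_apply]
  generalize deriv (deriv (U (n + 1))) x = w at *
  generalize deriv (deriv (U n)) x = z at *
  generalize deriv (U (n + 1)) x = F at *
  generalize deriv (V (n + 1)) x = G at *
  generalize deriv (U n) x = p at *
  generalize deriv (V n) x = r at *
  generalize U (n + 1) x = u₁ at *
  generalize V (n + 1) x = v₁ at *
  generalize U n x = u at *
  generalize V n x = v at *
  generalize u * v + d n = A at *
  generalize u₁ * v₁ + d (n + 1) = A₁ at *
  have hw : w = F * ((2 * v₁ * F + u₁ * G) / A₁ + z / p - (2 * v * p + u * r) / A) := by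
    have : F * (-w / F) = -w := by field_simp
    linear_combination (-F) * hJ' + this
  rw [hw]
  field_simp
  ring

/-- The right-hand side in `System.fderiv_quot` does not involve uₓₓ and vₓₓ, which are arbitrary;
two choices are subtracted. -/
theorem System.fderiv_quot_snd_snd (hS : S.Admissible β d) (hI : S.IsNIntegral (I₃ β d))
    (hJ : S.IsNIntegral (J₃ d)) {y : Args} (hy : y ∈ S.dom n) (w : ℝ × ℝ) :
    fderiv ℝ (S.quot d n) y (0, 0, w) = 0 := by
  obtain ⟨x, ⟨u, v, u₁, v₁⟩, ux, vx⟩ := y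
  have h1 := System.fderiv_quot hS hI hJ hy w.1 w.2
  have h2 := System.fderiv_quot hS hI hJ hy 0 0
  have h := sub_eq_zero.2 (h1.trans h2.symm)
  rw [← map_sub] at h
  simpa only [Prod.mk_sub_mk, sub_self, sub_zero, Prod.mk_zero_zero] using h

/-- The (uₓ, vₓ)-slices of a ball in the product metric are balls, hence connected. The equality
holds for (x, q) in a whole neighbourhood as well, so it may be differentiated. -/
theorem System.quot_eventuallyEq (hS : S.Admissible β d) (hI : S.IsNIntegral (I₃ β d))
    (hJ : S.IsNIntegral (J₃ d)) {x₀ : ℝ} {q : Base} {w₀ : ℝ × ℝ} (hy : (x₀, q, w₀) ∈ S.dom n) :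
    ∀ᶠ y in 𝓝 ((x₀, q, w₀) : Args),
      y ∈ S.dom n ∧ S.quot d n y = S.quot d n (y.1, y.2.1, w₀) := by
  obtain ⟨r, hr, hball⟩ := Metric.isOpen_iff.1 (S.isOpen_dom n) _ hy
  filter_upwards [Metric.ball_mem_nhds _ hr] with y hyr
  refine ⟨hball hyr, ?_⟩
  obtain ⟨x, p, w⟩ := y
  simp only [Metric.mem_ball, Prod.dist_eq, max_lt_iff] at hyr
  have hmem : ∀ w ∈ Metric.ball w₀ r, ((x, p, w) : Args) ∈ S.dom n := fun w hw => by
    refine hball ?_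
    simp only [Metric.mem_ball, Prod.dist_eq, max_lt_iff] at hw ⊢
    exact ⟨hyr.1, hyr.2.1, hw⟩
  have hd : ∀ w ∈ Metric.ball w₀ r,
      HasFDerivAt (fun w => S.quot d n (x, p, w)) (0 : ℝ × ℝ →L[ℝ] ℝ) w := fun w hw => by
    have h1 := ((System.contDiffAt_quot hS hI (hmem w hw)).differentiableAt (by simp)).hasFDerivAt
    have h2 := (hasFDerivAt_prodMk_right (𝕜 := ℝ) x (p, w)).comp w
      (hasFDerivAt_prodMk_right (𝕜 := ℝ) p w)
    refine (h1.comp w h2).congr_fderiv ?_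
    refine ContinuousLinearMap.ext fun z => ?_
    exact System.fderiv_quot_snd_snd hS hI hJ (hmem w hw) z
  refine Metric.isOpen_ball.is_const_of_fderiv_eq_zero
    (convex_ball w₀ r).isPreconnected (𝕜 := ℝ) (f := fun w => S.quot d n (x, p, w))
    (fun w hw => (hd w hw).differentiableAt.differentiableWithinAt)
    (fun w hw => (hd w hw).fderiv) ?_ (Metric.mem_ball_self hr)
  simp only [Metric.mem_ball, Prod.dist_eq, max_lt_iff]
  exact hyr.2.2

/-- The derivatives of `quot` in the directions of `x` and of the two characteristic fields. -/
theorem System.fderiv_quot_eq (hS : S.Admissible β d) (hI : S.IsNIntegral (I₃ β d))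
    (hJ : S.IsNIntegral (J₃ d)) {x u v u₁ v₁ : ℝ} {w₀ : ℝ × ℝ}
    (hy : (x, (u, v, u₁, v₁), w₀) ∈ S.dom n) {t : ℝ}
    (ht : t = S.quot d n (x, (u, v, u₁, v₁), w₀)) :
    fderiv ℝ (S.quot d n) (x, (u, v, u₁, v₁), w₀) (1, 0, 0) = 0 ∧
    fderiv ℝ (S.quot d n) (x, (u, v, u₁, v₁), w₀)
      (0, (1, 0, (u₁ * v₁ + d (n + 1)) / (t * (u * v + d n)),
        -β * v₁ ^ 2 / (t * (u * v + d n)) + β * v ^ 2 * t ^ β / (u * v + d n)), 0)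
      = (v * t - v₁) / (u * v + d n) ∧
    fderiv ℝ (S.quot d n) (x, (u, v, u₁, v₁), w₀) (0, (0, 1, 0, t ^ β), 0) = 0 := by
  set q : Base := (u, v, u₁, v₁) with hq
  set l := fderiv ℝ (S.quot d n) (x, q, w₀) with hl
  have hev := (System.quot_eventuallyEq hS hI hJ hy).eventually_nhds
  have hc : ContinuousAt (fun w : ℝ × ℝ => ((x, q, w) : Args)) w₀ := by fun_prop
  have hev' := hc.eventually hev
  have haff : ∀ᶠ w in 𝓝 w₀, l (1, 0, 0)
      + w.1 * (l (0, (1, 0, (u₁ * v₁ + d (n + 1)) / (t * (u * v + d n)),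
        -β * v₁ ^ 2 / (t * (u * v + d n)) + β * v ^ 2 * t ^ β / (u * v + d n)), 0)
        - (v * t - v₁) / (u * v + d n))
      + w.2 * l (0, (0, 1, 0, t ^ β), 0) = 0 := by
    filter_upwards [hev'] with w hw
    have hmem := hw.self_of_nhds.1
    have hval : S.quot d n (x, q, w) = t := by rw [ht]; exact hw.self_of_nhds.2
    -- Derivatives in the directions of x and (u, v, u₁, v₁) do not depend on `w` either, so the
    -- coefficients of the affine identity can be frozen at `w₀`.
    have hder : ∀ (a : ℝ) (b : Base), fderiv ℝ (S.quot d n) (x, q, w) (a, b, 0) = l (a, b, 0) := by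
      intro a b
      have h1 : HasFDerivAt (S.quot d n) l (x, q, w₀) :=
        ((System.contDiffAt_quot hS hI hy).differentiableAt (by simp)).hasFDerivAt
      have h2 := (hasFDerivAt_fst (𝕜 := ℝ) (p := ((x, q, w) : Args))).prodMk
        ((hasFDerivAt_snd (𝕜 := ℝ) (p := ((x, q, w) : Args))).fst.prodMk
          (hasFDerivAt_const w₀ ((x, q, w) : Args)))
      have h3 := (HasFDerivAt.comp (g := S.quot d n) (x, q, w) h1 h2).congr_of_eventuallyEq
        (hw.mono fun y hy => hy.2)
      rw [h3.fderiv]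
      rfl
    have h := System.fderiv_quot hS hI hJ (x := x) (ux := w.1) (vx := w.2) hmem 0 0
    change fderiv ℝ (S.quot d n) (x, q, w) (1, (w.1, w.2, S.f n (x, q, w), S.g n (x, q, w)), 0)
      = w.1 * (v * S.quot d n (x, q, w) - v₁) / (u * v + d n) at h
    have hf : S.f n (x, q, w) = _ :=
      System.f_eq hS hI (x := x) (ux := w.1) (vx := w.2) hmem
    have hg : S.g n (x, q, w) = _ :=
      System.g_eq hS hI (x := x) (ux := w.1) (vx := w.2) hmem
    change _ = (u₁ * v₁ + d (n + 1)) / (S.quot d n (x, q, w) * (u * v + d n)) * w.1 at hf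
    change _ = (-β * v₁ ^ 2 / (S.quot d n (x, q, w) * (u * v + d n))
        + β * v ^ 2 * S.quot d n (x, q, w) ^ β / (u * v + d n)) * w.1
        + S.quot d n (x, q, w) ^ β * w.2 at hg
    rw [hder, hf, hg, hval] at h
    have e : ((1, (w.1, w.2, (u₁ * v₁ + d (n + 1)) / (t * (u * v + d n)) * w.1,
        (-β * v₁ ^ 2 / (t * (u * v + d n)) + β * v ^ 2 * t ^ β / (u * v + d n)) * w.1
          + t ^ β * w.2), 0) : Args)
        = (1, 0, 0)
          + w.1 • ((0, (1, 0, (u₁ * v₁ + d (n + 1)) / (t * (u * v + d n)),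
            -β * v₁ ^ 2 / (t * (u * v + d n)) + β * v ^ 2 * t ^ β / (u * v + d n)), 0) : Args)
          + w.2 • ((0, (0, 1, 0, t ^ β), 0) : Args) := by
      ext <;> simp <;> ring
    rw [e, map_add, map_add, map_smul, map_smul, smul_eq_mul, smul_eq_mul] at h
    linear_combination h
  obtain ⟨h0, h1, h2⟩ := affine_eq_zero haff
  exact ⟨h0, sub_eq_zero.1 h1, h2⟩

/-- The gradient of `quot` along a slice vanishes; connectedness of the slices turns this into a
single value over each (u, v, u₁, v₁). -/
theorem System.quot_eq_of_slice (hS : S.Admissible β d) (hI : S.IsNIntegral (I₃ β d))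
    (hJ : S.IsNIntegral (J₃ d)) {q : Base} {y z : ℝ × ℝ × ℝ} (hy : (y.1, q, y.2) ∈ S.dom n)
    (hz : (z.1, q, z.2) ∈ S.dom n) :
    S.quot d n (y.1, q, y.2) = S.quot d n (z.1, q, z.2) := by
  have hd : ∀ z ∈ {y : ℝ × ℝ × ℝ | (y.1, q, y.2) ∈ S.dom n},
      HasFDerivAt (fun y : ℝ × ℝ × ℝ => S.quot d n (y.1, q, y.2)) (0 : ℝ × ℝ × ℝ →L[ℝ] ℝ) z := by
    intro z hz
    have h1 := ((System.contDiffAt_quot hS hI hz).differentiableAt (by simp)).hasFDerivAt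
    have h2 := (hasFDerivAt_fst (𝕜 := ℝ) (p := z)).prodMk
      ((hasFDerivAt_const (𝕜 := ℝ) q z).prodMk (hasFDerivAt_snd (𝕜 := ℝ) (p := z)))
    refine (HasFDerivAt.comp (g := S.quot d n) z h1 h2).congr_fderiv ?_
    refine ContinuousLinearMap.ext fun w => ?_
    obtain ⟨a, w⟩ := w
    change fderiv ℝ (S.quot d n) (z.1, q, z.2) (a, 0, w) = 0
    have e : ((a, 0, w) : Args) = a • ((1, 0, 0) : Args) + (0, 0, w) := by simp
    rw [e, map_add, map_smul, (System.fderiv_quot_eq hS hI hJ hz rfl).1,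
      System.fderiv_quot_snd_snd hS hI hJ hz, smul_zero, add_zero]
  have ho : IsOpen {y : ℝ × ℝ × ℝ | (y.1, q, y.2) ∈ S.dom n} :=
    (S.isOpen_dom n).preimage (f := fun y : ℝ × ℝ × ℝ => ((y.1, q, y.2) : Args)) (by fun_prop)
  exact ho.is_const_of_fderiv_eq_zero (S.slice_connected n q) (𝕜 := ℝ)
    (f := fun y : ℝ × ℝ × ℝ => S.quot d n (y.1, q, y.2))
    (fun w hw => (hd w hw).differentiableAt.differentiableWithinAt)
    (fun w hw => (hd w hw).fderiv) hy hz

/-- A system with the integrals `I₃`, `J₃` has the required form, with a function `𝒟` that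
satisfies the characteristic equations. -/
theorem System.exists_form_of_isNIntegral (hS : S.Admissible β d) (hI : S.IsNIntegral (I₃ β d))
    (hJ : S.IsNIntegral (J₃ d)) (n : ℕ) :
    ∃ 𝒟 : Base → ℝ, ContDiffOn ℝ ∞ 𝒟 (S.baseDom n) ∧
      (∀ q ∈ S.baseDom n, 𝒟 q ∈ powDom β) ∧
      (∀ y ∈ S.dom n, S.quot d n y = 𝒟 y.2.1) ∧
      ∀ q ∈ S.baseDom n, CharEqAt β (d n) (d (n + 1)) 𝒟 q := by
  classical
  -- The value 1 is taken only off `baseDom` and plays no role.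
  let 𝒟 : Base → ℝ := fun q =>
    if h : ∃ y : ℝ × ℝ × ℝ, (y.1, q, y.2) ∈ S.dom n then
      S.quot d n (h.choose.1, q, h.choose.2) else 1
  have h𝒟 : ∀ y ∈ S.dom n, S.quot d n y = 𝒟 y.2.1 := by
    intro y hy
    have h : ∃ z : ℝ × ℝ × ℝ, (z.1, y.2.1, z.2) ∈ S.dom n := ⟨(y.1, y.2.2), hy⟩
    simp only [𝒟, dif_pos h]
    exact System.quot_eq_of_slice hS hI hJ (y := (y.1, y.2.2)) hy h.choose_spec
  -- The chosen slice point varies with no regularity, but near a given point it can be replaced by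
  -- constant values of x, uₓ, vₓ; smoothness and derivatives of 𝒟 are read off from this.
  have hloc : ∀ y ∈ S.dom n, 𝒟 =ᶠ[𝓝 y.2.1] fun p => S.quot d n (y.1, p, y.2.2) := by
    intro y hy
    have hc : ContinuousAt (fun p : Base => ((y.1, p, y.2.2) : Args)) y.2.1 := by fun_prop
    filter_upwards [hc.eventually_mem ((S.isOpen_dom n).mem_nhds hy)] with p hp
    exact (h𝒟 _ hp).symm
  refine ⟨𝒟, ?_, ?_, h𝒟, ?_⟩
  · rintro q ⟨y, hy, rfl⟩
    refine ContDiffAt.contDiffWithinAt (ContDiffAt.congr_of_eventuallyEq ?_ (hloc y hy))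
    exact ContDiffAt.comp (g := S.quot d n) (f := fun p : Base => ((y.1, p, y.2.2) : Args)) y.2.1
      (System.contDiffAt_quot hS hI hy) (by fun_prop)
  · rintro q ⟨y, hy, rfl⟩
    rw [← h𝒟 y hy]
    exact System.quot_mem_powDom hS hI hy
  · rintro q ⟨y, hy, rfl⟩
    have hfd : ∀ b : Base, fderiv ℝ 𝒟 y.2.1 b = fderiv ℝ (S.quot d n) y (0, b, 0) := by
      intro b
      have h1 := ((System.contDiffAt_quot hS hI hy).differentiableAt (by simp)).hasFDerivAt
      have h2 := (hasFDerivAt_prodMk_right (𝕜 := ℝ) y.1 (y.2.1, y.2.2)).comp y.2.1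
        (hasFDerivAt_prodMk_left (𝕜 := ℝ) y.2.1 y.2.2)
      rw [((HasFDerivAt.comp (g := S.quot d n) y.2.1 h1 h2).congr_of_eventuallyEq
        (hloc y hy)).fderiv]
      rfl
    have ht := h𝒟 y hy
    have hpow := ne_zero_of_mem_powDom (System.quot_mem_powDom hS hI hy)
    rw [ht] at hpow
    obtain ⟨x, ⟨u, v, u₁, v₁⟩, w⟩ := y
    obtain ⟨-, hA, -⟩ := hS n _ _ _ _ _ _ _ hy
    have hA0 := ne_zero_of_mem_powDom hA
    obtain ⟨-, h1, h2⟩ := System.fderiv_quot_eq hS hI hJ hy ht.symm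
    simp only at hfd hpow ht h1 h2
    constructor
    · rw [hfd, h2]
    · rw [hfd]
      simp only
      generalize 𝒟 (u, v, u₁, v₁) = t at *
      have e : ((0, (t * (u * v + d n), 0, u₁ * v₁ + d (n + 1),
          β * (v ^ 2 * t * t ^ β - v₁ ^ 2)), 0) : Args)
          = (t * (u * v + d n)) • ((0, (1, 0, (u₁ * v₁ + d (n + 1)) / (t * (u * v + d n)),
            -β * v₁ ^ 2 / (t * (u * v + d n)) + β * v ^ 2 * t ^ β / (u * v + d n)), 0) : Args) := by
        simp only [Prod.smul_mk, smul_eq_mul, mul_zero, mul_one, smul_zero, Prod.mk.injEq, true_and,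
          and_true]
        generalize u * v + d n = A at *
        constructor <;> field_simp
        ring
      rw [e, map_smul, h1, smul_eq_mul]
      field_simp

end Integrals

/-! ### The commutator of the characteristic fields -/

/-- The equation for `𝒟` given by the commutator of the two characteristic fields. -/
theorem fderiv_commutator {β d d₁ : ℝ} {𝒟 : Base → ℝ} {u v u₁ v₁ : ℝ}
    (h𝒟 : ContDiffAt ℝ ∞ 𝒟 (u, v, u₁, v₁)) {t : ℝ} (ht : 𝒟 (u, v, u₁, v₁) = t) (ht0 : t ≠ 0)
    (h : ∀ᶠ p in 𝓝 (u, v, u₁, v₁), CharEqAt β d d₁ 𝒟 p) :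
    fderiv ℝ 𝒟 (u, v, u₁, v₁) (u * t, 0, u₁ * t ^ β, β * t ^ β * (v * t - v₁))
      = t * (t - t ^ β) := by
  set q : Base := (u, v, u₁, v₁) with hq
  have hd : HasFDerivAt 𝒟 (fderiv ℝ 𝒟 q) q := (h𝒟.differentiableAt (by simp)).hasFDerivAt
  have hdd : HasFDerivAt (fderiv ℝ 𝒟) (fderiv ℝ (fderiv ℝ 𝒟) q) q :=
    ((h𝒟.fderiv_right (m := 1) (by rw [one_add_one_eq_two]; exact two_le_infty)).differentiableAt (by simp)).hasFDerivAt
  have hsymm : IsSymmSndFDerivAt ℝ 𝒟 q :=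
    h𝒟.isSymmSndFDerivAt (by simpa using two_le_infty)
  obtain ⟨c1, c2⟩ := h.self_of_nhds
  change fderiv ℝ 𝒟 q (𝒟 q * (u * v + d), 0, u₁ * v₁ + d₁,
    β * (v ^ 2 * 𝒟 q * 𝒟 q ^ β - v₁ ^ 2)) = 𝒟 q * (v * 𝒟 q - v₁) at c2
  rw [ht] at c1 c2
  have curve : ∀ {ξ : Base} {c : ℝ → Base}, c 0 = q → HasDerivAt c ξ 0 →
      HasDerivAt (fun s => 𝒟 (c s)) (fderiv ℝ 𝒟 q ξ) 0 ∧
      HasDerivAt (fun s => fderiv ℝ 𝒟 (c s)) (fderiv ℝ (fderiv ℝ 𝒟) q ξ) 0 ∧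
      ∀ᶠ s in 𝓝 (0 : ℝ), CharEqAt β d d₁ 𝒟 (c s) := by
    intro ξ c hc0 hc
    refine ⟨?_, ?_, ?_⟩
    · exact HasFDerivAt.comp_hasDerivAt (l := 𝒟) 0 (hc0.symm ▸ hd) hc
    · exact HasFDerivAt.comp_hasDerivAt (l := fderiv ℝ 𝒟) 0 (hc0.symm ▸ hdd) hc
    · exact hc.continuousAt.eventually (hc0.symm ▸ h)
  have k0 : ∀ a : ℝ, HasDerivAt (fun _ : ℝ => a) 0 0 := fun a => hasDerivAt_const 0 a
  have l1 : HasDerivAt (fun s : ℝ => v + s) 1 0 := (hasDerivAt_id' (0 : ℝ)).const_add v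
  have l2 := hasDerivAt_add_mul v₁ (t ^ β)
  -- along the first field
  obtain ⟨e1, e2, e3⟩ := curve (c := fun s => (u, v + s, u₁, v₁ + s * t ^ β)) (by simp [hq])
    (hasDerivAt_base (k0 u) l1 (k0 u₁) l2)
  rw [c1] at e1
  have e4 := hasDerivAt_rpow_comp β e1 (by simpa [← hq, ht] using ht0)
  have g1 := hasDerivAt_base (e1.mul ((l1.const_mul u).add_const d)) (k0 0)
    ((l2.const_mul u₁).add_const d₁) (((((l1.pow 2).mul e1).mul e4).sub (l2.pow 2)).const_mul β)
  have r1 := e1.mul ((l1.mul e1).sub l2)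
  have z1 := ((e2.clm_apply g1).sub r1).unique
    ((hasDerivAt_const (0 : ℝ) (0 : ℝ)).congr_of_eventuallyEq
      (e3.mono fun s hs => sub_eq_zero.2 hs.second))
  -- along the second field
  have m1 := hasDerivAt_add_mul u (t * (u * v + d))
  have m2 := hasDerivAt_add_mul u₁ (u₁ * v₁ + d₁)
  have m3 := hasDerivAt_add_mul v₁ (β * (v ^ 2 * t * t ^ β - v₁ ^ 2))
  obtain ⟨f1, f2, f3⟩ := curve (c := fun s => (u + s * (t * (u * v + d)), v,
    u₁ + s * (u₁ * v₁ + d₁), v₁ + s * (β * (v ^ 2 * t * t ^ β - v₁ ^ 2)))) (by simp [hq])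
    (hasDerivAt_base m1 (k0 v) m2 m3)
  rw [c2] at f1
  have f4 := hasDerivAt_rpow_comp β f1 (by simpa [← hq, ht] using ht0)
  have z2 := (f2.clm_apply (hasDerivAt_base (k0 0) (k0 1) (k0 0) f4)).unique
    ((hasDerivAt_const (0 : ℝ) (0 : ℝ)).congr_of_eventuallyEq (f3.mono fun s hs => hs.first))
  simp only [Pi.mul_apply, Pi.sub_apply, Pi.pow_apply, zero_mul, add_zero, mul_zero, one_mul,
    zero_add, ← hq, ht, mul_one] at z1 z2
  -- By symmetry, the second-derivative terms of `z1` and `z2` coincide, so the difference is again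
  -- of first order.
  rw [hsymm.eq] at z1
  rw [show β * (t ^ β / t) * (t * (v * t - v₁)) = β * t ^ β * (v * t - v₁) by field_simp] at z2
  simp only [Nat.cast_ofNat, Nat.add_one_sub_one, pow_one] at z1
  have z4 : fderiv ℝ 𝒟 q (t * u, 0, u₁ * t ^ β, β * (2 * v * t * t ^ β - 2 * v₁ * t ^ β))
      - fderiv ℝ 𝒟 q (0, 0, 0, β * t ^ β * (v * t - v₁)) = t * (t - t ^ β) := by
    linear_combination z1 - z2
  rw [← map_sub] at z4
  rw [← z4]
  refine congrArg _ ?_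
  simp only [Prod.mk_sub_mk, Prod.mk.injEq]
  refine ⟨?_, ?_, ?_, ?_⟩ <;> ring

/-! ### Level sets of `(K₃, L₃)` -/

/-- The derivative of `u` with respect to `v₁` along a level set of `(K₃, L₃)`, parametrized by
`v`, `v₁` and the value `t` of `𝒟`. -/
def levelSlopeU (β d : ℝ) (z : Base × ℝ) : ℝ :=
  -(z.1.1 * (z.1.2.2.2 - z.1.2.1 * z.2 ^ β) + d * (z.2 - z.2 ^ β))
    / (β * (z.1.2.2.2 - z.1.2.1 * z.2 ^ β) ^ 2)

/-- The derivative of `u₁` with respect to `v₁` along a level set of `(K₃, L₃)`. -/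
def levelSlopeU₁ (β d₁ : ℝ) (z : Base × ℝ) : ℝ :=
  -(z.1.2.2.1 * z.2 * (z.1.2.2.2 - z.1.2.1 * z.2 ^ β) + d₁ * (z.2 - z.2 ^ β))
    / (β * z.2 * (z.1.2.2.2 - z.1.2.1 * z.2 ^ β) ^ 2)

/-- The derivative of `u` with respect to `t` along a level set of `(K₃, L₃)`. -/
def levelRateU (β d : ℝ) (z : Base × ℝ) : ℝ :=
  (z.1.1 * z.1.2.2.2 * (z.1.2.2.2 - z.1.2.1 * z.2 ^ β)
      + d * z.2 ^ β * (z.1.2.1 * z.2 - z.1.2.2.2))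
    / (z.2 * (z.1.2.2.2 - z.1.2.1 * z.2 ^ β) ^ 2)

/-- The derivative of `u₁` with respect to `t` along a level set of `(K₃, L₃)`. -/
def levelRateU₁ (β d₁ : ℝ) (z : Base × ℝ) : ℝ :=
  z.2 ^ β * (z.1.2.1 * z.2 * z.1.2.2.1 * (z.1.2.2.2 - z.1.2.1 * z.2 ^ β)
      + d₁ * (z.1.2.1 * z.2 - z.1.2.2.2))
    / (z.2 ^ 2 * (z.1.2.2.2 - z.1.2.1 * z.2 ^ β) ^ 2)

theorem clm_base_apply (l : Base →L[ℝ] ℝ) (a b c e : ℝ) :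
    l (a, b, c, e) = a * l (1, 0, 0, 0) + b * l (0, 1, 0, 0) + c * l (0, 0, 1, 0)
      + e * l (0, 0, 0, 1) := by
  simp only [← smul_eq_mul, ← map_smul, ← map_add]
  refine congrArg _ ?_
  simp

/-- The graph of `𝒟` is tangent to the level sets of `(K₃, L₃)`. -/
theorem fderiv_level {β d d₁ : ℝ} (hβ : β ≠ 0) {𝒟 : Base → ℝ} {u v u₁ v₁ : ℝ}
    (h𝒟 : ContDiffAt ℝ ∞ 𝒟 (u, v, u₁, v₁)) {t : ℝ} (ht : 𝒟 (u, v, u₁, v₁) = t) (ht0 : t ≠ 0)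
    (h : ∀ᶠ p in 𝓝 (u, v, u₁, v₁), CharEqAt β d d₁ 𝒟 p) (hW : v₁ - v * t ^ β ≠ 0) :
    fderiv ℝ 𝒟 (u, v, u₁, v₁) (levelSlopeU β d ((u, v, u₁, v₁), t), 0,
        levelSlopeU₁ β d₁ ((u, v, u₁, v₁), t), 1) = 0 ∧
      fderiv ℝ 𝒟 (u, v, u₁, v₁) (levelRateU β d ((u, v, u₁, v₁), t), 0,
        levelRateU₁ β d₁ ((u, v, u₁, v₁), t), 0) = 1 ∧
      fderiv ℝ 𝒟 (u, v, u₁, v₁) (0, 1, 0, t ^ β) = 0 := by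
  have c3 := fderiv_commutator h𝒟 ht ht0 h
  obtain ⟨c1, c2⟩ := h.self_of_nhds
  rw [ht] at c1 c2
  simp only at c2
  refine ⟨?_, ?_, c1⟩
  -- This combination of the second equation and the commutator equation cancels the right-hand
  -- sides; its coefficient of ∂_{v₁} is β t W², which is why W ≠ 0 is needed.
  · rw [clm_base_apply] at c2 c3 ⊢
    simp only [levelSlopeU, levelSlopeU₁]
    obtain ⟨w, rfl⟩ : ∃ w, v₁ = w + v * t ^ β := ⟨v₁ - v * t ^ β, by ring⟩
    rw [add_sub_cancel_right] at hW ⊢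
    generalize fderiv ℝ 𝒟 _ (1, 0, 0, 0) = a at *
    generalize fderiv ℝ 𝒟 _ (0, 1, 0, 0) = b at *
    generalize fderiv ℝ 𝒟 _ (0, 0, 1, 0) = c at *
    generalize fderiv ℝ 𝒟 _ (0, 0, 0, 1) = e at *
    generalize t ^ β = P at *
    field_simp
    linear_combination (-(t - P)) * c2 + (v * t - (w + v * P)) * c3
  -- Here the combination eliminates ∂_{v₁} instead.
  · rw [clm_base_apply] at c2 c3 ⊢
    simp only [levelRateU, levelRateU₁]
    obtain ⟨w, rfl⟩ : ∃ w, v₁ = w + v * t ^ β := ⟨v₁ - v * t ^ β, by ring⟩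
    rw [add_sub_cancel_right] at hW ⊢
    generalize fderiv ℝ 𝒟 _ (1, 0, 0, 0) = a at *
    generalize fderiv ℝ 𝒟 _ (0, 1, 0, 0) = b at *
    generalize fderiv ℝ 𝒟 _ (0, 0, 1, 0) = c at *
    generalize fderiv ℝ 𝒟 _ (0, 0, 0, 1) = e at *
    generalize t ^ β = P at *
    field_simp
    linear_combination P * (v * t - (w + v * P)) * c2
      - (v ^ 2 * t * P - (w + v * P) ^ 2) * c3

/-- `u₁` as a function on the level set `L₃ = l`. -/
def levelU₁ (β d₁ l v v₁ t : ℝ) : ℝ :=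
  (l / |v₁ - v * t ^ β| ^ ((1 - β) * β⁻¹) - d₁ * t ^ (β - 1) + d₁)
    / ((β - 1) * (v₁ - v * t ^ β))

/-- `u` as a function on the level set `K₃ = k`, `L₃ = l`. -/
def levelU (β d d₁ k l v v₁ t : ℝ) : ℝ :=
  (k * t / |v₁ - v * t ^ β| ^ β⁻¹ + d * levelU₁ β d₁ l v v₁ t * t) / d₁

/-- The parametrization of the space of `(u, v, u₁, v₁, t)` by `(K₃, L₃, v, v₁, t)`. -/
def levelChart (β d d₁ : ℝ) (y : (ℝ × ℝ) × ℝ × ℝ × ℝ) : Base × ℝ :=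
  ((levelU β d d₁ y.1.1 y.1.2 y.2.1 y.2.2.1 y.2.2.2, y.2.1,
    levelU₁ β d₁ y.1.2 y.2.1 y.2.2.1 y.2.2.2, y.2.2.1), y.2.2.2)

theorem abs_rpow_ne_zero {w c : ℝ} (hw : w ≠ 0) : |w| ^ c ≠ 0 :=
  (Real.rpow_pos_of_pos (abs_pos.2 hw) c).ne'

/-- L₃ is affine in u₁ with slope (β-1) W |W|^((1-β)/β), and K₃ is affine in u with slope d₁
|W|^(1/β)/t. Since β ≠ 1 and d₁ ≠ 0, the two can be solved successively for u₁ and u. -/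
theorem levelChart_K₃_L₃ {β d d₁ : ℝ} (hβ1 : β ≠ 1) (hd₁ : d₁ ≠ 0) {u v u₁ v₁ t : ℝ}
    (ht : t ≠ 0) (hW : v₁ - v * t ^ β ≠ 0) :
    levelChart β d d₁ ((K₃ β d d₁ (u, v, u₁, v₁) t, L₃ β d₁ (u, v, u₁, v₁) t), v, v₁, t)
      = ((u, v, u₁, v₁), t) := by
  have hβ : β - 1 ≠ 0 := sub_ne_zero.2 hβ1
  have n1 := abs_rpow_ne_zero (c := (1 - β) * β⁻¹) hW
  have n2 := abs_rpow_ne_zero (c := β⁻¹) hW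
  have e1 : levelU₁ β d₁ (L₃ β d₁ (u, v, u₁, v₁) t) v v₁ t = u₁ := by
    simp only [levelU₁, L₃]
    rw [mul_div_cancel_left₀ _ n1]
    field_simp
    ring
  simp only [levelChart, Prod.mk.injEq, true_and, and_true]
  refine ⟨?_, e1⟩
  simp only [levelU, e1, K₃]
  field_simp
  ring

theorem contDiffAt_levelChart {β d d₁ : ℝ} (hβ1 : β ≠ 1) (hd₁ : d₁ ≠ 0)
    {y : (ℝ × ℝ) × ℝ × ℝ × ℝ} (ht : y.2.2.2 ≠ 0) (hW : y.2.2.1 - y.2.1 * y.2.2.2 ^ β ≠ 0) :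
    ContDiffAt ℝ ∞ (levelChart β d d₁) y := by
  have hβ : β - 1 ≠ 0 := sub_ne_zero.2 hβ1
  have hpow : ∀ c : ℝ, ContDiffAt ℝ ∞ (fun y : (ℝ × ℝ) × ℝ × ℝ × ℝ => y.2.2.2 ^ c) y := fun c =>
    (Real.contDiffAt_rpow_const_of_ne ht).comp (f := fun y : (ℝ × ℝ) × ℝ × ℝ × ℝ => y.2.2.2) y
      (by fun_prop)
  have hp := hpow β
  have hp1 := hpow (β - 1)
  have hw : ContDiffAt ℝ ∞
      (fun y : (ℝ × ℝ) × ℝ × ℝ × ℝ => y.2.2.1 - y.2.1 * y.2.2.2 ^ β) y := by fun_prop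
  have habs : ∀ c : ℝ, ContDiffAt ℝ ∞
      (fun y : (ℝ × ℝ) × ℝ × ℝ × ℝ => |y.2.2.1 - y.2.1 * y.2.2.2 ^ β| ^ c) y := fun c =>
    (contDiffAt_abs_rpow c hW).comp
      (f := fun y : (ℝ × ℝ) × ℝ × ℝ × ℝ => y.2.2.1 - y.2.1 * y.2.2.2 ^ β) y hw
  have h1 : ContDiffAt ℝ ∞
      (fun y : (ℝ × ℝ) × ℝ × ℝ × ℝ => levelU₁ β d₁ y.1.2 y.2.1 y.2.2.1 y.2.2.2) y := by
    unfold levelU₁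
    refine ContDiffAt.div (ContDiffAt.add (ContDiffAt.sub (ContDiffAt.div (by fun_prop)
      (habs _) (abs_rpow_ne_zero hW)) (by fun_prop)) contDiffAt_const) (by fun_prop)
      (mul_ne_zero hβ hW)
  have h2 : ContDiffAt ℝ ∞
      (fun y : (ℝ × ℝ) × ℝ × ℝ × ℝ => levelU β d d₁ y.1.1 y.1.2 y.2.1 y.2.2.1 y.2.2.2) y := by
    unfold levelU
    refine ContDiffAt.div (ContDiffAt.add (ContDiffAt.div (by fun_prop)
      (habs _) (abs_rpow_ne_zero hW)) (by fun_prop)) contDiffAt_const hd₁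
  unfold levelChart
  fun_prop

/-- The velocity of a curve in a level set of `(K₃, L₃)`. -/
theorem hasDerivAt_levelChart {β d d₁ : ℝ} (hβ0 : β ≠ 0) (hβ1 : β ≠ 1) (hd₁ : d₁ ≠ 0)
    {k l : ℝ} {v v₁ t : ℝ → ℝ} {v' v₁' t' s : ℝ} (hv : HasDerivAt v v' s)
    (hv₁ : HasDerivAt v₁ v₁' s) (ht : HasDerivAt t t' s) (ht0 : t s ≠ 0)
    (hW : v₁ s - v s * t s ^ β ≠ 0) {z : Base × ℝ}
    (hz : z = levelChart β d d₁ ((k, l), v s, v₁ s, t s)) :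
    HasDerivAt (fun s => (levelChart β d d₁ ((k, l), v s, v₁ s, t s)).1)
      (v₁' • ((levelSlopeU β d z, 0, levelSlopeU₁ β d₁ z, 1) : Base)
        + t' • ((levelRateU β d z, 0, levelRateU₁ β d₁ z, 0) : Base)
        + v' • (((0, 1, 0, z.2 ^ β) : Base)
          - z.2 ^ β • ((levelSlopeU β d z, 0, levelSlopeU₁ β d₁ z, 1) : Base))) s := by
  have hβ : β - 1 ≠ 0 := sub_ne_zero.2 hβ1
  have hp := hasDerivAt_rpow_comp β ht ht0
  have hp1 := hasDerivAt_rpow_comp (β - 1) ht ht0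
  have hw := hv₁.sub (hv.mul hp)
  have hm := hasDerivAt_abs_rpow_comp β⁻¹ hw hW
  have hm1 := hasDerivAt_abs_rpow_comp ((1 - β) * β⁻¹) hw hW
  have n1 := abs_rpow_ne_zero (c := (1 - β) * β⁻¹) hW
  have n2 := abs_rpow_ne_zero (c := β⁻¹) hW
  have hu₁ : HasDerivAt (fun s => levelU₁ β d₁ l (v s) (v₁ s) (t s))
      (v₁' * levelSlopeU₁ β d₁ z + t' * levelRateU₁ β d₁ z
        - v' * t s ^ β * levelSlopeU₁ β d₁ z) s := by
    have h := (((((hasDerivAt_const s l).div hm1 n1).sub (hp1.const_mul d₁)).add_const d₁).div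
      (hw.const_mul (β - 1)) (mul_ne_zero hβ hW))
    refine h.congr_deriv ?_
    subst hz
    simp only [levelSlopeU₁, levelRateU₁, levelChart, levelU₁, Pi.sub_apply, Pi.mul_apply,
      Pi.div_apply, Real.rpow_sub_one ht0]
    generalize |v₁ s - v s * t s ^ β| ^ ((1 - β) * β⁻¹) = M at *
    obtain ⟨w, hw'⟩ : ∃ w, v₁ s = w + v s * t s ^ β := ⟨v₁ s - v s * t s ^ β, by ring⟩
    rw [hw', add_sub_cancel_right] at hW ⊢
    generalize t s ^ β = P at *
    field_simp
    ring
  have hu : HasDerivAt (fun s => levelU β d d₁ k l (v s) (v₁ s) (t s))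
      (v₁' * levelSlopeU β d z + t' * levelRateU β d z
        - v' * t s ^ β * levelSlopeU β d z) s := by
    have h := ((((ht.const_mul k).div hm n2).add ((hu₁.const_mul d).mul ht)).div_const d₁)
    refine h.congr_deriv ?_
    subst hz
    simp only [levelSlopeU₁, levelRateU₁, levelSlopeU, levelRateU, levelChart, levelU,
      Pi.sub_apply, Pi.mul_apply]
    generalize levelU₁ β d₁ l (v s) (v₁ s) (t s) = U₁ at *
    generalize |v₁ s - v s * t s ^ β| ^ β⁻¹ = M at *
    obtain ⟨w, hw'⟩ : ∃ w, v₁ s = w + v s * t s ^ β := ⟨v₁ s - v s * t s ^ β, by ring⟩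
    rw [hw', add_sub_cancel_right] at hW ⊢
    generalize t s ^ β = P at *
    field_simp
    ring
  refine (hasDerivAt_base hu hv hu₁ hv₁).congr_deriv ?_
  have hz2 : z.2 = t s := by rw [hz]; rfl
  rw [hz2]
  ext <;> simp <;> ring

/-! ### Recovering the implicit equation from the characteristic equations -/

/-- A function that is smooth near a point agrees there with a globally smooth function. -/
theorem exists_contDiff_eventuallyEq {E : Type*} [NormedAddCommGroup E] [NormedSpace ℝ E]
    [FiniteDimensional ℝ E] {h : E → ℝ} {x₀ : E} (hh : ∀ᶠ x in 𝓝 x₀, ContDiffAt ℝ ∞ h x) :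
    ∃ H : E → ℝ, ContDiff ℝ ∞ H ∧ H =ᶠ[𝓝 x₀] h := by
  obtain ⟨r, hr, hball⟩ := Metric.eventually_nhds_iff_ball.1 hh
  -- The support, the closed ball of radius r/2, stays inside the ball on which `h` is smooth.
  let χ : ContDiffBump x₀ := ⟨r / 3, r / 2, by positivity, by linarith⟩
  refine ⟨fun x => χ x * h x, ?_, ?_⟩
  · refine contDiff_iff_contDiffAt.2 fun x => ?_
    by_cases hx : x ∈ Metric.ball x₀ r
    · exact χ.contDiff.contDiffAt.mul (hball x hx)
    · have hx' : x ∉ tsupport χ := by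
        rw [χ.tsupport_eq]
        refine fun h => hx (Metric.closedBall_subset_ball ?_ h)
        change r / 2 < r
        linarith
      have h0 : (fun x => χ x * h x) =ᶠ[𝓝 x] fun _ => 0 := by
        filter_upwards [notMem_tsupport_iff_eventuallyEq.1 hx'] with y hy
        simp only [hy, Pi.zero_apply, zero_mul]
      exact contDiffAt_const.congr_of_eventuallyEq h0
  · filter_upwards [χ.eventuallyEq_one] with x hx
    simp only [hx, Pi.one_apply, one_mul]

section Slopes

variable {β d d₁ : ℝ} {z : Base × ℝ}

theorem contDiffAt_levelSlopeU (hβ : β ≠ 0) (ht : z.2 ≠ 0)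
    (hW : z.1.2.2.2 - z.1.2.1 * z.2 ^ β ≠ 0) : ContDiffAt ℝ ∞ (levelSlopeU β d) z := by
  have hp : ContDiffAt ℝ ∞ (fun z : Base × ℝ => z.2 ^ β) z :=
    (Real.contDiffAt_rpow_const_of_ne ht).comp z contDiffAt_snd
  unfold levelSlopeU
  exact ContDiffAt.div (by fun_prop) (by fun_prop) (mul_ne_zero hβ (pow_ne_zero 2 hW))

theorem contDiffAt_levelSlopeU₁ (hβ : β ≠ 0) (ht : z.2 ≠ 0)
    (hW : z.1.2.2.2 - z.1.2.1 * z.2 ^ β ≠ 0) : ContDiffAt ℝ ∞ (levelSlopeU₁ β d₁) z := by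
  have hp : ContDiffAt ℝ ∞ (fun z : Base × ℝ => z.2 ^ β) z :=
    (Real.contDiffAt_rpow_const_of_ne ht).comp z contDiffAt_snd
  unfold levelSlopeU₁
  exact ContDiffAt.div (by fun_prop) (by fun_prop)
    (mul_ne_zero (mul_ne_zero hβ ht) (pow_ne_zero 2 hW))

theorem contDiffAt_levelRateU (ht : z.2 ≠ 0)
    (hW : z.1.2.2.2 - z.1.2.1 * z.2 ^ β ≠ 0) : ContDiffAt ℝ ∞ (levelRateU β d) z := by
  have hp : ContDiffAt ℝ ∞ (fun z : Base × ℝ => z.2 ^ β) z :=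
    (Real.contDiffAt_rpow_const_of_ne ht).comp z contDiffAt_snd
  unfold levelRateU
  exact ContDiffAt.div (by fun_prop) (by fun_prop) (mul_ne_zero ht (pow_ne_zero 2 hW))

theorem contDiffAt_levelRateU₁ (ht : z.2 ≠ 0)
    (hW : z.1.2.2.2 - z.1.2.1 * z.2 ^ β ≠ 0) : ContDiffAt ℝ ∞ (levelRateU₁ β d₁) z := by
  have hp : ContDiffAt ℝ ∞ (fun z : Base × ℝ => z.2 ^ β) z :=
    (Real.contDiffAt_rpow_const_of_ne ht).comp z contDiffAt_snd
  unfold levelRateU₁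
  exact ContDiffAt.div (by fun_prop) (by fun_prop)
    (mul_ne_zero (pow_ne_zero 2 ht) (pow_ne_zero 2 hW))

end Slopes

/-- The amount by which the level sets of `(K₃, L₃)` fail to be tangent to the translates of the
graph of `𝒟` in the direction of `t`. -/
def tangencyDefect (β d d₁ : ℝ) (𝒟 : Base → ℝ) (z : Base × ℝ) : ℝ × ℝ × ℝ :=
  (fderiv ℝ 𝒟 z.1 (levelSlopeU β d z, 0, levelSlopeU₁ β d₁ z, 1),
    fderiv ℝ 𝒟 z.1 (levelRateU β d z, 0, levelRateU₁ β d₁ z, 0) - 1,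
    fderiv ℝ 𝒟 z.1 (0, 1, 0, z.2 ^ β)
      - z.2 ^ β * fderiv ℝ 𝒟 z.1 (levelSlopeU β d z, 0, levelSlopeU₁ β d₁ z, 1))

section Implicit

variable {β d d₁ : ℝ} {𝒟 : Base → ℝ} {q : Base}

theorem tangencyDefect_eq_zero (hβ : β ≠ 0)
    (h : ∀ᶠ p in 𝓝 q, ContDiffAt ℝ ∞ 𝒟 p ∧ 𝒟 p ≠ 0 ∧ CharEqAt β d d₁ 𝒟 p)
    (hW : q.2.2.2 - q.2.1 * 𝒟 q ^ β ≠ 0) : tangencyDefect β d d₁ 𝒟 (q, 𝒟 q) = 0 := by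
  obtain ⟨h𝒟, h0, -⟩ := h.self_of_nhds
  obtain ⟨u, v, u₁, v₁⟩ := q
  obtain ⟨e1, e2, e3⟩ := fderiv_level hβ h𝒟 rfl h0 (h.mono fun p hp => hp.2.2) hW
  simp only [tangencyDefect, e1, e2, e3]
  simp

theorem contDiffAt_tangencyDefect (hβ : β ≠ 0) {t : ℝ} (h𝒟 : ContDiffAt ℝ ∞ 𝒟 q) (ht : t ≠ 0)
    (hW : q.2.2.2 - q.2.1 * t ^ β ≠ 0) : ContDiffAt ℝ 1 (tangencyDefect β d d₁ 𝒟) (q, t) := by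
  have one_le : (1 : WithTop ℕ∞) ≤ ∞ := by exact_mod_cast le_top
  have hf : ContDiffAt ℝ 1 (fun z : Base × ℝ => fderiv ℝ 𝒟 z.1) (q, t) :=
    ContDiffAt.comp (g := fderiv ℝ 𝒟) (q, t)
      (h𝒟.fderiv_right (by rw [one_add_one_eq_two]; exact two_le_infty)) contDiffAt_fst
  have hp : ContDiffAt ℝ 1 (fun z : Base × ℝ => z.2 ^ β) (q, t) :=
    (Real.contDiffAt_rpow_const_of_ne ht).comp (q, t) contDiffAt_snd
  have h1 := (contDiffAt_levelSlopeU (d := d) (z := (q, t)) hβ ht hW).of_le one_le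
  have h2 := (contDiffAt_levelSlopeU₁ (d₁ := d₁) (z := (q, t)) hβ ht hW).of_le one_le
  have h3 := (contDiffAt_levelRateU (d := d) (z := (q, t)) ht hW).of_le one_le
  have h4 := (contDiffAt_levelRateU₁ (d₁ := d₁) (z := (q, t)) ht hW).of_le one_le
  have g1 := hf.clm_apply (h1.prodMk ((contDiffAt_const (c := (0 : ℝ))).prodMk
    (h2.prodMk (contDiffAt_const (c := (1 : ℝ))))))
  have g2 := hf.clm_apply (h3.prodMk ((contDiffAt_const (c := (0 : ℝ))).prodMk
    (h4.prodMk (contDiffAt_const (c := (0 : ℝ))))))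
  have g3 := hf.clm_apply ((contDiffAt_const (c := (0 : ℝ))).prodMk
    ((contDiffAt_const (c := (1 : ℝ))).prodMk ((contDiffAt_const (c := (0 : ℝ))).prodMk hp)))
  exact g1.prodMk ((g2.sub contDiffAt_const).prodMk (g3.sub (hp.mul g1)))

theorem eventually_sub_mul_rpow_ne_zero {z : Base × ℝ} (ht : z.2 ≠ 0)
    (hW : z.1.2.2.2 - z.1.2.1 * z.2 ^ β ≠ 0) :
    ∀ᶠ z : Base × ℝ in 𝓝 z, z.2 ≠ 0 ∧ z.1.2.2.2 - z.1.2.1 * z.2 ^ β ≠ 0 :=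
  (continuousAt_snd.eventually_ne ht).and
    ((contDiffAt_sub_mul_rpow β ht).continuousAt.eventually_ne hW)

/-- The defect is C¹, hence locally Lipschitz, and vanishes on the graph; `z` is compared with the
graph point over `z.1`. -/
theorem exists_norm_tangencyDefect_le (hβ : β ≠ 0)
    (h : ∀ᶠ p in 𝓝 q, ContDiffAt ℝ ∞ 𝒟 p ∧ 𝒟 p ≠ 0 ∧ CharEqAt β d d₁ 𝒟 p)
    (hW : q.2.2.2 - q.2.1 * 𝒟 q ^ β ≠ 0) :
    ∃ C : ℝ, ∀ᶠ z in 𝓝 (q, 𝒟 q), ‖tangencyDefect β d d₁ 𝒟 z‖ ≤ C * ‖z.2 - 𝒟 z.1‖ := by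
  obtain ⟨h𝒟, h0, -⟩ := h.self_of_nhds
  obtain ⟨C, N, hN, hLip⟩ :=
    (contDiffAt_tangencyDefect (d := d) (d₁ := d₁) hβ h𝒟 h0 hW).exists_lipschitzOnWith
  refine ⟨C, ?_⟩
  have hgraph : Tendsto (fun p => (p, 𝒟 p)) (𝓝 q) (𝓝 (q, 𝒟 q)) :=
    continuousAt_id.prodMk h𝒟.continuousAt
  have hzero : ∀ᶠ p in 𝓝 q, (p, 𝒟 p) ∈ N ∧ tangencyDefect β d d₁ 𝒟 (p, 𝒟 p) = 0 := by
    filter_upwards [hgraph.eventually_mem hN, h.eventually_nhds,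
      hgraph.eventually (eventually_sub_mul_rpow_ne_zero (z := (q, 𝒟 q)) h0 hW)] with p h1 h2 h3
    exact ⟨h1, tangencyDefect_eq_zero hβ h2 h3.2⟩
  filter_upwards [hN, (continuousAt_fst (p := (q, 𝒟 q))).eventually hzero] with z hz hz'
  have := hLip.dist_le_mul z hz _ hz'.1
  rw [hz'.2, dist_zero_right] at this
  refine this.trans_eq ?_
  obtain ⟨p, t⟩ := z
  rw [Prod.dist_eq, dist_self, max_eq_right dist_nonneg, Real.dist_eq, Real.norm_eq_abs]

/-- On the graph of `𝒟`, the value of `𝒟` is transported along the level sets of `(K₃, L₃)`. -/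
theorem eventually_eq_levelChart (hβ0 : β ≠ 0) (hβ1 : β ≠ 1) (hd₁ : d₁ ≠ 0)
    (h : ∀ᶠ p in 𝓝 q, ContDiffAt ℝ ∞ 𝒟 p ∧ 𝒟 p ≠ 0 ∧ CharEqAt β d d₁ 𝒟 p)
    (hW : q.2.2.2 - q.2.1 * 𝒟 q ^ β ≠ 0) :
    ∀ᶠ p in 𝓝 q, 𝒟 q - 𝒟 (levelChart β d d₁ ((K₃ β d d₁ p (𝒟 p), L₃ β d₁ p (𝒟 p)),
      q.2.1, q.2.2.2, 𝒟 q)).1 = 0 := by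
  obtain ⟨h𝒟, h0, -⟩ := h.self_of_nhds
  obtain ⟨C, hC⟩ := exists_norm_tangencyDefect_le hβ0 h hW
  have hgraph : ContinuousAt (fun p => (p, 𝒟 p)) q := continuousAt_id.prodMk h𝒟.continuousAt
  set Y : Base → (ℝ × ℝ) × ℝ × ℝ × ℝ :=
    fun p => ((K₃ β d d₁ p (𝒟 p), L₃ β d₁ p (𝒟 p)), p.2.1, p.2.2.2, 𝒟 p) with hY
  have hchart : levelChart β d d₁ (Y q) = (q, 𝒟 q) :=
    levelChart_K₃_L₃ (u := q.1) (v := q.2.1) (u₁ := q.2.2.1) (v₁ := q.2.2.2) hβ1 hd₁ h0 hW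
  have hYc : ContinuousAt Y q := by
    have hK := ContinuousAt.comp (f := fun p => (p, 𝒟 p)) (g := fun z : Base × ℝ => K₃ β d d₁ z.1 z.2)
      (x := q)      (contDiffAt_K₃ β d d₁ (z := (q, 𝒟 q)) h0 hW).continuousAt hgraph
    have hL := ContinuousAt.comp (f := fun p => (p, 𝒟 p)) (g := fun z : Base × ℝ => L₃ β d₁ z.1 z.2)
      (x := q)      (contDiffAt_L₃ β d₁ (z := (q, 𝒟 q)) h0 hW).continuousAt hgraph
    have h2 : ContinuousAt (fun p : Base => (p.2.1, p.2.2.2)) q := by fun_prop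
    exact (hK.prodMk hL).prodMk (h2.fst.prodMk (h2.snd.prodMk h𝒟.continuousAt))
  have hcc : ContinuousAt (levelChart β d d₁) (Y q) :=
    (contDiffAt_levelChart hβ1 hd₁ (y := Y q) h0 hW).continuousAt
  have hgood : ∀ᶠ z in 𝓝 (q, 𝒟 q), ((z.2 ≠ 0 ∧ z.1.2.2.2 - z.1.2.1 * z.2 ^ β ≠ 0) ∧
      ContDiffAt ℝ ∞ 𝒟 z.1) ∧ ‖tangencyDefect β d d₁ 𝒟 z‖ ≤ C * ‖z.2 - 𝒟 z.1‖ :=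
    ((eventually_sub_mul_rpow_ne_zero (z := (q, 𝒟 q)) h0 hW).and
      ((continuousAt_fst (p := (q, 𝒟 q))).eventually (h.mono fun p hp => hp.1))).and hC
  rw [← hchart] at hgood
  obtain ⟨r, hr, hball⟩ := Metric.eventually_nhds_iff_ball.1 (hcc.eventually hgood)
  filter_upwards [hYc.eventually_mem (Metric.ball_mem_nhds _ hr),
    hgraph.eventually (eventually_sub_mul_rpow_ne_zero (z := (q, 𝒟 q)) h0 hW)] with p hp hp0
  set k := K₃ β d d₁ p (𝒟 p) with hk
  set l := L₃ β d₁ p (𝒟 p) with hl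
  -- The endpoint takes its level values from `p` and the other coordinates from `q`, so in the sup
  -- metric it is as close to `Y q` as `Y p` is.
  have hp' : ((k, l), q.2.1, q.2.2.2, 𝒟 q) ∈ Metric.ball (Y q) r := by
    simp only [hY, Metric.mem_ball, Prod.dist_eq, max_lt_iff, dist_self] at hp ⊢
    exact ⟨hp.1, by simpa using hr⟩
  -- A straight segment in the chart from `p` to the transversal through `q`; `k` and `l` are
  -- frozen, so its image stays in one level set.
  set v : ℝ → ℝ := fun s => p.2.1 + s * (q.2.1 - p.2.1) with hv
  set v₁ : ℝ → ℝ := fun s => p.2.2.2 + s * (q.2.2.2 - p.2.2.2) with hv₁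
  set t : ℝ → ℝ := fun s => 𝒟 p + s * (𝒟 q - 𝒟 p) with ht
  have lin : ∀ a b s : ℝ, HasDerivAt (fun s : ℝ => a + s * b) b s := fun a b s => by
    simpa using ((hasDerivAt_id s).mul_const b).const_add a
  set y : ℝ → (ℝ × ℝ) × ℝ × ℝ × ℝ := fun s => ((k, l), v s, v₁ s, t s) with hy
  have hmem : ∀ s ∈ Set.Icc (0 : ℝ) 1, y s ∈ Metric.ball (Y q) r := by
    intro s hs
    have hconv := (convex_ball (Y q) r).add_smul_sub_mem hp hp' hs
    convert hconv using 1
    simp [hy, hY, hv, hv₁, ht, ← hk, ← hl]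
  set z : ℝ → Base × ℝ := fun s => levelChart β d d₁ (y s) with hz
  have hder : ∀ s ∈ Set.Icc (0 : ℝ) 1, HasDerivAt (fun s => t s - 𝒟 (z s).1)
      (-((q.2.2.2 - p.2.2.2) * (tangencyDefect β d d₁ 𝒟 (z s)).1
        + (𝒟 q - 𝒟 p) * (tangencyDefect β d d₁ 𝒟 (z s)).2.1
        + (q.2.1 - p.2.1) * (tangencyDefect β d d₁ 𝒟 (z s)).2.2)) s := by
    intro s hs
    obtain ⟨⟨⟨ht0, hW0⟩, hD⟩, -⟩ := hball _ (hmem s hs)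
    have hc := hasDerivAt_levelChart (d := d) (k := k) (l := l) hβ0 hβ1 hd₁
      (lin p.2.1 (q.2.1 - p.2.1) s) (lin p.2.2.2 (q.2.2.2 - p.2.2.2) s)
      (lin (𝒟 p) (𝒟 q - 𝒟 p) s) ht0 hW0 (z := z s) rfl
    have hD' := HasFDerivAt.comp_hasDerivAt (l := 𝒟) s
      (hD.differentiableAt (by simp)).hasFDerivAt hc
    refine ((lin (𝒟 p) (𝒟 q - 𝒟 p) s).sub hD').congr_deriv ?_
    simp only [map_add, map_sub, map_smul, smul_eq_mul, tangencyDefect]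
    change _ - ((q.2.2.2 - p.2.2.2) * fderiv ℝ 𝒟 (z s).1 _ + _ * fderiv ℝ 𝒟 (z s).1 _
      + _ * (fderiv ℝ 𝒟 (z s).1 _ - _ * fderiv ℝ 𝒟 (z s).1 _)) = _
    ring
  -- Off the graph, tangency holds only up to a multiple of |t - 𝒟|. This is enough for Gronwall: t
  -- - 𝒟 vanishes at the start and therefore all along the segment.
  have hzero := eq_zero_of_abs_deriv_le_mul_abs_self_of_eq_zero_right (a := 0) (b := 1)
    (K := (|q.2.2.2 - p.2.2.2| + |𝒟 q - 𝒟 p| + |q.2.1 - p.2.1|) * C)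
    (f := fun s => t s - 𝒟 (z s).1)
    (fun s hs => (hder s hs).continuousAt.continuousWithinAt)
    (fun s hs => (hder s (Set.Ico_subset_Icc_self hs)).hasDerivWithinAt) ?_ ?_ 1
    (Set.right_mem_Icc.2 zero_le_one)
  · simpa [hz, hy, hv, hv₁, ht] using hzero
  · have : z 0 = (p, 𝒟 p) := by
      simp only [hz, hy, hv, hv₁, ht, zero_mul, add_zero]
      exact levelChart_K₃_L₃ (u := p.1) (v := p.2.1) (u₁ := p.2.2.1) (v₁ := p.2.2.2)
        hβ1 hd₁ hp0.1 hp0.2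
    simp [this, ht]
  · intro s hs
    have hb := (hball _ (hmem s (Set.Ico_subset_Icc_self hs))).2
    change ‖tangencyDefect β d d₁ 𝒟 (z s)‖ ≤ C * ‖t s - 𝒟 (z s).1‖ at hb
    generalize tangencyDefect β d d₁ 𝒟 (z s) = w at *
    have w1 : ‖w.1‖ ≤ ‖w‖ := norm_fst_le w
    have w2 : ‖w.2.1‖ ≤ ‖w‖ := (norm_fst_le w.2).trans (norm_snd_le w)
    have w3 : ‖w.2.2‖ ≤ ‖w‖ := (norm_snd_le w.2).trans (norm_snd_le w)
    rw [norm_neg]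
    calc _ ≤ |q.2.2.2 - p.2.2.2| * ‖w.1‖ + |𝒟 q - 𝒟 p| * ‖w.2.1‖ + |q.2.1 - p.2.1| * ‖w.2.2‖ := by
          refine (norm_add₃_le).trans_eq ?_
          simp only [norm_mul, Real.norm_eq_abs]
      _ ≤ |q.2.2.2 - p.2.2.2| * ‖w‖ + |𝒟 q - 𝒟 p| * ‖w‖ + |q.2.1 - p.2.1| * ‖w‖ := by gcongr
      _ = (|q.2.2.2 - p.2.2.2| + |𝒟 q - 𝒟 p| + |q.2.1 - p.2.1|) * ‖w‖ := by ring
      _ ≤ (|q.2.2.2 - p.2.2.2| + |𝒟 q - 𝒟 p| + |q.2.1 - p.2.1|)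
          * (C * ‖t s - 𝒟 (z s).1‖) := by gcongr
      _ = _ := by ring

/-- Let G(a, s) be 𝒟 at the chart point with the level values of (q, a) and last coordinate s. The
chart returns q on the diagonal, so G is constant there, while ∂G/∂s = 1 by tangency. Hence ∂G/∂a =
-1, the sign being reversed by the subtraction. -/
theorem hasDerivAt_sub_levelChart (hβ0 : β ≠ 0) (hβ1 : β ≠ 1) (hd₁ : d₁ ≠ 0)
    (h : ∀ᶠ p in 𝓝 q, ContDiffAt ℝ ∞ 𝒟 p ∧ 𝒟 p ≠ 0 ∧ CharEqAt β d d₁ 𝒟 p)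
    (hW : q.2.2.2 - q.2.1 * 𝒟 q ^ β ≠ 0) :
    HasDerivAt (fun t => 𝒟 q - 𝒟 (levelChart β d d₁ ((K₃ β d d₁ q t, L₃ β d₁ q t),
      q.2.1, q.2.2.2, 𝒟 q)).1) 1 (𝒟 q) := by
  obtain ⟨h𝒟, h0, -⟩ := h.self_of_nhds
  set t₀ := 𝒟 q with ht₀
  have hchart : ∀ t : ℝ, t ≠ 0 → q.2.2.2 - q.2.1 * t ^ β ≠ 0 →
      levelChart β d d₁ ((K₃ β d d₁ q t, L₃ β d₁ q t), q.2.1, q.2.2.2, t) = (q, t) :=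
    fun t ht hWt =>
      levelChart_K₃_L₃ (u := q.1) (v := q.2.1) (u₁ := q.2.2.1) (v₁ := q.2.2.2) hβ1 hd₁ ht hWt
  set Y : ℝ × ℝ → (ℝ × ℝ) × ℝ × ℝ × ℝ :=
    fun a => ((K₃ β d d₁ q a.1, L₃ β d₁ q a.1), q.2.1, q.2.2.2, a.2) with hY
  set G : ℝ × ℝ → ℝ := fun a => 𝒟 (levelChart β d d₁ (Y a)).1 with hG
  have hYd : DifferentiableAt ℝ Y (t₀, t₀) := by
    have hin : DifferentiableAt ℝ (fun a : ℝ × ℝ => (q, a.1)) (t₀, t₀) := by fun_prop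
    have hK := DifferentiableAt.comp (g := fun z : Base × ℝ => K₃ β d d₁ z.1 z.2) (t₀, t₀)
      ((contDiffAt_K₃ β d d₁ (z := (q, t₀)) h0 hW).differentiableAt (by simp)) hin
    have hL := DifferentiableAt.comp (g := fun z : Base × ℝ => L₃ β d₁ z.1 z.2) (t₀, t₀)
      ((contDiffAt_L₃ β d₁ (z := (q, t₀)) h0 hW).differentiableAt (by simp)) hin
    exact (hK.prodMk hL).prodMk (by fun_prop)
  have hcd : DifferentiableAt ℝ (levelChart β d d₁) (Y (t₀, t₀)) :=
    (contDiffAt_levelChart hβ1 hd₁ (y := Y (t₀, t₀)) h0 hW).differentiableAt (by simp)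
  have hq : levelChart β d d₁ (Y (t₀, t₀)) = (q, t₀) := hchart t₀ h0 hW
  have h𝒟' : DifferentiableAt ℝ 𝒟 (levelChart β d d₁ (Y (t₀, t₀))).1 := by
    rw [hq]
    exact h𝒟.differentiableAt (by simp)
  have hGd : HasFDerivAt G (fderiv ℝ G (t₀, t₀)) (t₀, t₀) :=
    (DifferentiableAt.comp (g := 𝒟) (t₀, t₀) h𝒟' ((hcd.comp (t₀, t₀) hYd).fst)).hasFDerivAt
  have e1 : fderiv ℝ G (t₀, t₀) (1, 1) = 0 := by
    have hc : HasDerivAt (fun t : ℝ => (t, t)) ((1 : ℝ), (1 : ℝ)) t₀ :=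
      (hasDerivAt_id' t₀).prodMk (hasDerivAt_id' t₀)
    refine (HasFDerivAt.comp_hasDerivAt (l := G) (f := fun t : ℝ => (t, t)) t₀ hGd hc).unique
      ((hasDerivAt_const t₀ (𝒟 q)).congr_of_eventuallyEq ?_)
    have hin : ContinuousAt (fun t : ℝ => (q, t)) t₀ := by fun_prop
    filter_upwards [hin.eventually (eventually_sub_mul_rpow_ne_zero (z := (q, t₀)) h0 hW)]
      with t ht
    simp only [Function.comp_apply, hG, hY, hchart t ht.1 ht.2]
  have e2 : fderiv ℝ G (t₀, t₀) (0, 1) = 1 := by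
    have hc : HasDerivAt (fun t : ℝ => (t₀, t)) ((0 : ℝ), (1 : ℝ)) t₀ :=
      (hasDerivAt_const t₀ t₀).prodMk (hasDerivAt_id' t₀)
    refine (HasFDerivAt.comp_hasDerivAt (l := G) t₀ hGd hc).unique ?_
    have hv := hasDerivAt_levelChart (d := d) (k := K₃ β d d₁ q t₀) (l := L₃ β d₁ q t₀) hβ0 hβ1 hd₁
      (hasDerivAt_const t₀ q.2.1) (hasDerivAt_const t₀ q.2.2.2) (hasDerivAt_id' t₀) h0 hW hq.symm
    refine (HasFDerivAt.comp_hasDerivAt (l := 𝒟) t₀ h𝒟'.hasFDerivAt hv).congr_deriv ?_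
    rw [hq]
    simp only [zero_smul, zero_add, add_zero, one_smul]
    have := congrArg (fun w : ℝ × ℝ × ℝ => w.2.1) (tangencyDefect_eq_zero hβ0 h hW)
    simpa [tangencyDefect, sub_eq_zero] using this
  have e3 : fderiv ℝ G (t₀, t₀) (1, 0) = -1 := by
    have : ((1, 0) : ℝ × ℝ) = (1, 1) - (0, 1) := by simp
    rw [this, map_sub, e1, e2, zero_sub]
  have hc : HasDerivAt (fun t : ℝ => (t, t₀)) ((1 : ℝ), (0 : ℝ)) t₀ :=
    (hasDerivAt_id' t₀).prodMk (hasDerivAt_const t₀ t₀)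
  refine ((HasFDerivAt.comp_hasDerivAt (l := G) (f := fun t : ℝ => (t, t₀)) t₀ hGd hc).const_sub t₀).congr_deriv ?_
  rw [e3, neg_neg]

/-- H is t - 𝒟 on the transversal where v, v₁, t have their values at q, as a function of the level
values (k, l), made globally smooth by a cutoff. The derivative in t is 1 at q, hence nonzero nearby
by continuity. -/
theorem givenImplicitlyAt_of_charEqAt (hβ0 : β ≠ 0) (hβ1 : β ≠ 1) (hd₁ : d₁ ≠ 0)
    (h : ∀ᶠ p in 𝓝 q, ContDiffAt ℝ ∞ 𝒟 p ∧ 𝒟 p ≠ 0 ∧ CharEqAt β d d₁ 𝒟 p)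
    (hW : q.2.2.2 - q.2.1 * 𝒟 q ^ β ≠ 0) : GivenImplicitlyAt β d d₁ 𝒟 q := by
  obtain ⟨h𝒟, h0, -⟩ := h.self_of_nhds
  set Y : ℝ × ℝ → (ℝ × ℝ) × ℝ × ℝ × ℝ := fun a => (a, q.2.1, q.2.2.2, 𝒟 q) with hY
  have hYc : ContDiff ℝ ∞ Y := by
    rw [hY]
    fun_prop
  set KL : Base × ℝ → ℝ × ℝ := fun z => (K₃ β d d₁ z.1 z.2, L₃ β d₁ z.1 z.2) with hKL
  have hKLc : ContDiffAt ℝ ∞ KL (q, 𝒟 q) :=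
    (contDiffAt_K₃ β d d₁ (z := (q, 𝒟 q)) h0 hW).prodMk
      (contDiffAt_L₃ β d₁ (z := (q, 𝒟 q)) h0 hW)
  have hchart : levelChart β d d₁ (Y (KL (q, 𝒟 q))) = (q, 𝒟 q) :=
    levelChart_K₃_L₃ (u := q.1) (v := q.2.1) (u₁ := q.2.2.1) (v₁ := q.2.2.2) hβ1 hd₁ h0 hW
  have hcY : ∀ a, ContDiffAt ℝ ∞ (fun a => (levelChart β d d₁ (Y a)).1) a := fun a =>
    ContDiffAt.fst (ContDiffAt.comp (g := levelChart β d d₁) a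
      (contDiffAt_levelChart hβ1 hd₁ (y := Y a) h0 hW) hYc.contDiffAt)
  have hsm : ∀ᶠ a in 𝓝 (KL (q, 𝒟 q)),
      ContDiffAt ℝ ∞ (fun a => 𝒟 q - 𝒟 (levelChart β d d₁ (Y a)).1) a := by
    have hc := (hcY (KL (q, 𝒟 q))).continuousAt
    have hev : ∀ᶠ p in 𝓝 (levelChart β d d₁ (Y (KL (q, 𝒟 q)))).1, ContDiffAt ℝ ∞ 𝒟 p := by
      rw [hchart]
      exact h.mono fun p hp => hp.1
    filter_upwards [hc.eventually hev] with a ha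
    exact contDiffAt_const.sub (ContDiffAt.comp (g := 𝒟) a ha (hcY a))
  obtain ⟨H, hH, hHeq⟩ := exists_contDiff_eventuallyEq hsm
  have hN : ContDiffAt ℝ ∞ (fun z => H (KL z)) (q, 𝒟 q) := hH.contDiffAt.comp (q, 𝒟 q) hKLc
  have hgraph : ContinuousAt (fun p => (p, 𝒟 p)) q := continuousAt_id.prodMk h𝒟.continuousAt
  have hder : ∀ z : Base × ℝ, DifferentiableAt ℝ (fun z => H (KL z)) z →
      deriv (fun t => H (K₃ β d d₁ z.1 t, L₃ β d₁ z.1 t)) z.2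
        = fderiv ℝ (fun z => H (KL z)) z (0, 1) := fun z hz => by
    have hc : HasDerivAt (fun t : ℝ => (z.1, t)) ((0 : Base), (1 : ℝ)) z.2 :=
      (hasDerivAt_const z.2 z.1).prodMk (hasDerivAt_id' z.2)
    exact (HasFDerivAt.comp_hasDerivAt (l := fun z => H (KL z)) z.2 hz.hasFDerivAt hc).deriv
  have hne : fderiv ℝ (fun z => H (KL z)) (q, 𝒟 q) (0, 1) ≠ 0 := by
    rw [← hder (q, 𝒟 q) (hN.differentiableAt (by simp))]
    have hin : ContinuousAt (fun t : ℝ => KL (q, t)) (𝒟 q) :=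
      ContinuousAt.comp (g := KL) hKLc.continuousAt (by fun_prop)
    have := (hasDerivAt_sub_levelChart hβ0 hβ1 hd₁ h hW).congr_of_eventuallyEq
      (f₁ := fun t => H (KL (q, t))) (hin.eventually hHeq)
    exact this.deriv.trans_ne one_ne_zero
  have hdiff : ∀ᶠ z in 𝓝 (q, 𝒟 q), DifferentiableAt ℝ (fun z => H (KL z)) z := by
    have := (hN.of_le (m := 1) (by exact_mod_cast le_top)).eventually (by simp)
    exact this.mono fun z hz => hz.differentiableAt (by simp)
  have hcont : ContinuousAt (fun z => fderiv ℝ (fun z => H (KL z)) z (0, 1)) (q, 𝒟 q) :=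
    ((hN.fderiv_right (m := 0) (by simp)).continuousAt).clm_apply continuousAt_const
  refine ⟨H, hH, ?_⟩
  filter_upwards [eventually_eq_levelChart hβ0 hβ1 hd₁ h hW,
    (ContinuousAt.comp (f := fun p => (p, 𝒟 p)) (g := KL) (x := q) hKLc.continuousAt hgraph).eventually hHeq,
    hgraph.eventually (hdiff.and (hcont.eventually_ne hne))] with p h1 h2 h3
  refine ⟨?_, ?_⟩
  · exact h2.trans h1
  · exact (hder (p, 𝒟 p) h3.1).trans_ne h3.2

end Implicit

end SemiDiscrete

end

theorem theorem3 (β : ℝ) (hβ0 : β ≠ 0) (hβ1 : β ≠ 1) (d : ℕ → ℝ) (hd : ∀ n, d n ≠ 0)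
    (S : SemiDiscrete.System) (hS : S.Admissible β d) :
    (S.IsNIntegral (SemiDiscrete.I₃ β d) ∧ S.IsNIntegral (SemiDiscrete.J₃ d)) ↔
      S.HasForm₃ β d := by
  constructor
  · rintro ⟨hI, hJ⟩ n
    obtain ⟨𝒟, h𝒟, hpow, hquot, hchar⟩ :=
      SemiDiscrete.System.exists_form_of_isNIntegral hS hI hJ n
    refine ⟨𝒟, h𝒟, hpow, ?_, ?_⟩
    · intro x u v u₁ v₁ ux vx hy
      rw [SemiDiscrete.System.f_eq hS hI hy, SemiDiscrete.System.g_eq hS hI hy, hquot _ hy]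
      exact ⟨rfl, rfl⟩
    · intro u v u₁ v₁ hq
      refine or_iff_not_imp_left.2 fun hW => ?_
      have hB := S.isOpen_baseDom n
      refine SemiDiscrete.givenImplicitlyAt_of_charEqAt hβ0 hβ1 (hd (n + 1)) ?_ hW
      filter_upwards [hB.mem_nhds hq] with p hp
      exact ⟨h𝒟.contDiffAt (hB.mem_nhds hp), SemiDiscrete.ne_zero_of_mem_powDom (hpow p hp),
        hchar p hp⟩
  · exact fun h => ⟨SemiDiscrete.System.HasForm₃.isNIntegral_I₃ hS h,
      SemiDiscrete.System.HasForm₃.isNIntegral_J₃ hβ0 hS h⟩
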